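/- Let $p\ge 3$ be odd and let $q\in\mathbb C$ be a primitive $p$-th root of unity. Let $A(E(1,1|p))$ be the complex algebra generated by $\eta_+,\eta_-,\delta^{\pm1}$ with relations $$\eta_-\eta_+=q^2\eta_+\eta_-,\qquad \eta_\pm\delta=q^2\delta\eta_\pm,\qquad \delta^p=1,\qquad \eta_\pm^p=0,$$ and coproduct the algebra homomorphism with $\Delta(\eta_\pm)=\eta_\pm\otimes1+\delta^{\pm1}\otimes\eta_\pm$, $\Delta(\delta)=\delta\otimes\delta$. Let $\mathcal I$ be the linear functional on $A(E(1,1|p))$ with $\mathcal I(\eta_+^n\eta_-^m\delta^k)=q^{-1}\delta_{n,p-1}\delta_{m,p-1}\delta_{k,0\,(\mathrm{mod}\ p)}$ for $0\le n,m\le p-1$. Put $[n]=\frac{q^n-q^{-n}}{q-q^{-1}}$, $[n]!=[1]\cdots[n]$ and $$B_\pm=(-1)^{\frac{p+1}2}\sum_{n=1}^{p-1}\frac{q^{\pm n^2}}{[p-n]!\,[n]!}\,\eta_\pm^{p-n}\delta^{\pm n}\otimes\eta_\pm^n .$$ Let $C_0^\infty(\mathbb R^2)$ be the space of smooth compactly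 supported complex functions of $z=(z_+,z_-)$, and let $A_0(E_q(1,1))=A(E(1,1|p))\otimes C_0^\infty(\mathbb R^2)$ be the space of finite sums $F=\sum_n a_nf_n$ with $a_n\in A(E(1,1|p))$, $f_n\in C_0^\infty(\mathbb R^2)$. The coproduct of the quantum Poincaré group $E_q(1,1)$ is given on it by $\Delta(af)=\Delta(a)\Delta(f)$, $$\Delta(f)=f(Z)+\frac{\partial f}{\partial z_+}(Z)\,B_++\frac{\partial f}{\partial z_-}(Z)\,B_-+\frac{\partial^2 f}{\partial z_+\partial z_-}(Z)\,B_+B_-,$$ where $Z=z\otimes1+1\otimes z$, i.e. $g(Z)$ is the function $(x,y)\mapsto g(x+y)$ on $\mathbb R^2\times\mathbb R^2$. A linear functional $J$ on $A_0(E_q(1,1))$ is called an invariant integral on $E_q(1,1)$ if $(\mathrm{id}\otimes J)\Delta(F)=J(F)\,1$ and $(J\otimes\mathrm{id})\Delta(F)=J(F)\,1$ for all $F\in A_0(E_q(1,1))$, where $J$ is applied for each fixed value of the $\mathbb R^2$-variable of the other factor. Then the linear functional $$\mathcal I_E\Big(\sum_n a_nf_n\Big)=\sum_n\mathcal I(a_n)\int_{-\infty}^{\infty}\!\int_{-\infty}^{\infty}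 f_n(z_+,z_-)\,dz_+\,dz_-$$ is a nonzero invariant integral on $E_q(1,1)$, and it is unique up to a scalar: every invariant integral on $E_q(1,1)$ is of the form $c\,\mathcal I_E$ with $c\in\mathbb C$. -/

import Mathlib

open scoped TensorProduct ContDiff

namespace QPoincare

/-! ## q-numbers -/

/-- `[n] = (q^n - q^{-n}) / (q - q^{-1})`. -/
noncomputable def qNum (q : ℂ) (n : ℕ) : ℂ := (q ^ n - (q ^ n)⁻¹) / (q - q⁻¹)

/-- `[n]! = [1] [2] ⋯ [n]`. -/
noncomputable def qFact (q : ℂ) (n : ℕ) : ℂ := ∏ i ∈ Finset.range n, qNum q (i + 1)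

/-! ## The reduced quantum Poincaré group `E(1,1|p)` -/

/-- The generators `η₊, η₋, δ, δ⁻¹`. -/
inductive Gen : Type
  | etaP : Gen
  | etaM : Gen
  | delta : Gen
  | deltaInv : Gen

/-- The defining relations of `A(E(1,1|p))`. -/
inductive Rel (p : ℕ) (q : ℂ) : FreeAlgebra ℂ Gen → FreeAlgebra ℂ Gen → Prop
  | eta_eta : Rel p q (FreeAlgebra.ι ℂ Gen.etaM * FreeAlgebra.ι ℂ Gen.etaP)
      (q ^ 2 • (FreeAlgebra.ι ℂ Gen.etaP * FreeAlgebra.ι ℂ Gen.etaM))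
  | etaP_delta : Rel p q (FreeAlgebra.ι ℂ Gen.etaP * FreeAlgebra.ι ℂ Gen.delta)
      (q ^ 2 • (FreeAlgebra.ι ℂ Gen.delta * FreeAlgebra.ι ℂ Gen.etaP))
  | etaM_delta : Rel p q (FreeAlgebra.ι ℂ Gen.etaM * FreeAlgebra.ι ℂ Gen.delta)
      (q ^ 2 • (FreeAlgebra.ι ℂ Gen.delta * FreeAlgebra.ι ℂ Gen.etaM))
  | delta_inv : Rel p q (FreeAlgebra.ι ℂ Gen.delta * FreeAlgebra.ι ℂ Gen.deltaInv) 1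
  | inv_delta : Rel p q (FreeAlgebra.ι ℂ Gen.deltaInv * FreeAlgebra.ι ℂ Gen.delta) 1
  | delta_pow : Rel p q (FreeAlgebra.ι ℂ Gen.delta ^ p) 1
  | etaP_pow : Rel p q (FreeAlgebra.ι ℂ Gen.etaP ^ p) 0
  | etaM_pow : Rel p q (FreeAlgebra.ι ℂ Gen.etaM ^ p) 0

/-- The complex algebra `A(E(1,1|p))` with generators `η₊, η₋, δ^{±1}` and relations
`η₋η₊ = q²η₊η₋`, `η_±δ = q²δη_±`, `δ^p = 1`, `η_±^p = 0`. -/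
abbrev RedAlg (p : ℕ) (q : ℂ) : Type := RingQuot (Rel p q)

section Generators

variable (p : ℕ) (q : ℂ)

/-- The class of a generator in `A(E(1,1|p))`. -/
noncomputable def gen (g : Gen) : RedAlg p q :=
  RingQuot.mkAlgHom ℂ (Rel p q) (FreeAlgebra.ι ℂ g)

/-- `η₊` -/
noncomputable def etaP : RedAlg p q := gen p q Gen.etaP
/-- `η₋` -/
noncomputable def etaM : RedAlg p q := gen p q Gen.etaM
/-- `δ` -/
noncomputable def delta : RedAlg p q := gen p q Gen.delta
/-- `δ⁻¹` -/
noncomputable def deltaInv : RedAlg p q := gen p q Gen.deltaInv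

theorem etaM_etaP : etaM p q * etaP p q = q ^ 2 • (etaP p q * etaM p q) := by
  have h := RingQuot.mkAlgHom_rel ℂ (Rel.eta_eta (p := p) (q := q))
  rw [map_smul, map_mul, map_mul] at h
  exact h

theorem etaP_delta : etaP p q * delta p q = q ^ 2 • (delta p q * etaP p q) := by
  have h := RingQuot.mkAlgHom_rel ℂ (Rel.etaP_delta (p := p) (q := q))
  rw [map_smul, map_mul, map_mul] at h
  exact h

theorem etaM_delta : etaM p q * delta p q = q ^ 2 • (delta p q * etaM p q) := by
  have h := RingQuot.mkAlgHom_rel ℂ (Rel.etaM_delta (p := p) (q := q))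
  rw [map_smul, map_mul, map_mul] at h
  exact h

theorem delta_deltaInv : delta p q * deltaInv p q = 1 := by
  have h := RingQuot.mkAlgHom_rel ℂ (Rel.delta_inv (p := p) (q := q))
  rw [map_one, map_mul] at h
  exact h

theorem deltaInv_delta : deltaInv p q * delta p q = 1 := by
  have h := RingQuot.mkAlgHom_rel ℂ (Rel.inv_delta (p := p) (q := q))
  rw [map_one, map_mul] at h
  exact h

theorem delta_pow : delta p q ^ p = 1 := by
  have h := RingQuot.mkAlgHom_rel ℂ (Rel.delta_pow (p := p) (q := q))
  rw [map_one, map_pow] at h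
  exact h

theorem etaP_pow : etaP p q ^ p = 0 := by
  have h := RingQuot.mkAlgHom_rel ℂ (Rel.etaP_pow (p := p) (q := q))
  rw [map_zero, map_pow] at h
  exact h

theorem etaM_pow : etaM p q ^ p = 0 := by
  have h := RingQuot.mkAlgHom_rel ℂ (Rel.etaM_pow (p := p) (q := q))
  rw [map_zero, map_pow] at h
  exact h

theorem deltaInv_etaP : deltaInv p q * etaP p q = q ^ 2 • (etaP p q * deltaInv p q) := by
  calc deltaInv p q * etaP p q
      = deltaInv p q * (etaP p q * delta p q) * deltaInv p q := by
        rw [mul_assoc, mul_assoc (etaP p q), delta_deltaInv, mul_one]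
    _ = q ^ 2 • (etaP p q * deltaInv p q) := by
        rw [etaP_delta, mul_smul_comm, ← mul_assoc, deltaInv_delta, one_mul, smul_mul_assoc]

theorem deltaInv_etaM : deltaInv p q * etaM p q = q ^ 2 • (etaM p q * deltaInv p q) := by
  calc deltaInv p q * etaM p q
      = deltaInv p q * (etaM p q * delta p q) * deltaInv p q := by
        rw [mul_assoc, mul_assoc (etaM p q), delta_deltaInv, mul_one]
    _ = q ^ 2 • (etaM p q * deltaInv p q) := by
        rw [etaM_delta, mul_smul_comm, ← mul_assoc, deltaInv_delta, one_mul, smul_mul_assoc]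

theorem deltaInv_pow : deltaInv p q ^ p = 1 := by
  have hc : Commute (deltaInv p q) (delta p q) := by
    rw [commute_iff_eq, deltaInv_delta, delta_deltaInv]
  have h := hc.mul_pow p
  rw [deltaInv_delta, one_pow, delta_pow, mul_one] at h
  exact h.symm

end Generators

/-! ### The q-binomial theorem at a root of unity -/

/-- Gaussian binomial coefficients at `μ`. -/
def gauss (μ : ℂ) : ℕ → ℕ → ℂ
  | _, 0 => 1
  | 0, _ + 1 => 0
  | n + 1, m + 1 => gauss μ n (m + 1) + μ ^ (n - m) * gauss μ n m

theorem gauss_zero (μ : ℂ) (n : ℕ) : gauss μ n 0 = 1 := by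
  cases n <;> simp [gauss]

theorem gauss_eq_zero (μ : ℂ) : ∀ n m : ℕ, n < m → gauss μ n m = 0
  | 0, m + 1, _ => by simp [gauss]
  | n + 1, m + 1, h => by
      rw [gauss, gauss_eq_zero μ n (m + 1) (by omega), gauss_eq_zero μ n m (by omega)]
      simp

theorem gauss_ratio (μ : ℂ) : ∀ n m : ℕ, m ≤ n →
    (1 - μ ^ (m + 1)) * gauss μ n (m + 1) = (1 - μ ^ (n - m)) * gauss μ n m
  | 0, m, h => by
      obtain rfl : m = 0 := by omega
      simp [gauss]
  | n + 1, 0, _ => by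
      have h := gauss_ratio μ n 0 (by omega)
      simp only [gauss, gauss_zero, Nat.sub_zero, zero_add, pow_one, mul_one] at h ⊢
      rw [mul_add, h]
      ring
  | n + 1, m + 1, h => by
      rcases Nat.lt_or_ge m n with hmn | hmn
      · have h1 := gauss_ratio μ n (m + 1) (by omega)
        have h2 := gauss_ratio μ n m (by omega)
        obtain ⟨k, rfl⟩ : ∃ k, n = m + 1 + k := ⟨n - (m + 1), by omega⟩
        have e1 : m + 1 + k - (m + 1) = k := by omega
        have e2 : m + 1 + k - m = k + 1 := by omega
        have e3 : m + 1 + k + 1 - (m + 1) = k + 1 := by omega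
        rw [e1] at h1
        rw [e2] at h2
        rw [gauss, gauss, e1, e2, e3]
        linear_combination h1 + μ ^ k * μ * h2
      · obtain rfl : m = n := by omega
        rw [gauss_eq_zero μ (m + 1) (m + 1 + 1) (by omega)]
        simp

theorem add_pow_gauss {R : Type*} [Ring R] [Algebra ℂ R] (μ : ℂ) (X Y : R)
    (h : Y * X = μ • (X * Y)) (n : ℕ) :
    (X + Y) ^ n = ∑ m ∈ Finset.range (n + 1), gauss μ n m • (X ^ (n - m) * Y ^ m) := by
  have hYX : ∀ j : ℕ, Y * X ^ j = μ ^ j • (X ^ j * Y) := by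
    intro j
    induction j with
    | zero => simp
    | succ j ih =>
      rw [pow_succ, ← mul_assoc, ih, smul_mul_assoc, mul_assoc, h, mul_smul_comm, smul_smul,
        ← mul_assoc, pow_succ]
  induction n with
  | zero => simp [gauss]
  | succ n ih =>
    have hX : X * (X + Y) ^ n
        = X ^ (n + 1) + ∑ m ∈ Finset.range (n + 1),
            gauss μ n (m + 1) • (X ^ (n - m) * Y ^ (m + 1)) := by
      rw [ih, Finset.sum_range_succ (fun m => gauss μ n (m + 1) • (X ^ (n - m) * Y ^ (m + 1))),
        gauss_eq_zero μ n (n + 1) (by omega), zero_smul, add_zero, Finset.sum_range_succ', mul_add,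
        Finset.mul_sum, add_comm]
      congr 1
      · rw [gauss_zero, one_smul, Nat.sub_zero, pow_zero, mul_one, pow_succ']
      · refine Finset.sum_congr rfl fun m hm => ?_
        have hm' : m < n := Finset.mem_range.mp hm
        rw [mul_smul_comm, ← mul_assoc, ← pow_succ', show n - (m + 1) + 1 = n - m by omega]
    have hY : Y * (X + Y) ^ n
        = ∑ m ∈ Finset.range (n + 1),
            (μ ^ (n - m) * gauss μ n m) • (X ^ (n - m) * Y ^ (m + 1)) := by
      rw [ih, Finset.mul_sum]
      refine Finset.sum_congr rfl fun m _ => ?_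
      rw [mul_smul_comm, ← mul_assoc, hYX, smul_mul_assoc, smul_smul, mul_assoc, ← pow_succ',
        mul_comm]
    rw [pow_succ', add_mul, hX, hY, Finset.sum_range_succ' _ (n + 1), add_assoc,
      ← Finset.sum_add_distrib, add_comm]
    congr 1
    · refine Finset.sum_congr rfl fun m _ => ?_
      rw [← add_smul, gauss, Nat.add_sub_add_right]
    · rw [gauss_zero, one_smul, Nat.sub_zero, pow_zero, mul_one]

theorem add_pow_root {R : Type*} [Ring R] [Algebra ℂ R] {p : ℕ} (hp : 0 < p) {μ : ℂ}
    (hμ : IsPrimitiveRoot μ p) (X Y : R) (h : Y * X = μ • (X * Y))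
    (hX : X ^ p = 0) (hY : Y ^ p = 0) : (X + Y) ^ p = 0 := by
  have hg : ∀ m, m + 1 < p → gauss μ p (m + 1) = 0 := by
    intro m
    induction m with
    | zero =>
      intro h1
      have hr := gauss_ratio μ p 0 (by omega)
      rw [Nat.sub_zero, hμ.pow_eq_one, sub_self, zero_mul] at hr
      exact (mul_eq_zero.mp hr).resolve_left
        (sub_ne_zero.mpr (hμ.pow_ne_one_of_pos_of_lt (by omega) h1).symm)
    | succ m ih =>
      intro h1
      have hr := gauss_ratio μ p (m + 1) (by omega)
      rw [ih (by omega), mul_zero] at hr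
      exact (mul_eq_zero.mp hr).resolve_left
        (sub_ne_zero.mpr (hμ.pow_ne_one_of_pos_of_lt (by omega) h1).symm)
  rw [add_pow_gauss μ X Y h]
  refine Finset.sum_eq_zero fun m hm => ?_
  have hm' : m < p + 1 := Finset.mem_range.mp hm
  rcases Nat.eq_zero_or_pos m with rfl | h0
  · simp [hX]
  · rcases Nat.lt_or_ge m p with h1 | h1
    · obtain ⟨k, rfl⟩ : ∃ k, m = k + 1 := ⟨m - 1, by omega⟩
      rw [hg k h1, zero_smul]
    · obtain rfl : m = p := by omega
      rw [hY, mul_zero, smul_zero]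

theorem sq_primitive {p : ℕ} {q : ℂ} (hp : Odd p) (hq : IsPrimitiveRoot q p) :
    IsPrimitiveRoot (q ^ 2) p :=
  hq.pow_of_coprime 2 (Nat.coprime_two_left.mpr hp)

/-! ### The coproduct of `E(1,1|p)` -/

/-- `Δ(η_±) = η_± ⊗ 1 + δ^{±1} ⊗ η_±` and `Δ(δ^{±1}) = δ^{±1} ⊗ δ^{±1}`. -/
noncomputable def comulGen (p : ℕ) (q : ℂ) : Gen → RedAlg p q ⊗[ℂ] RedAlg p q
  | Gen.etaP => etaP p q ⊗ₜ 1 + delta p q ⊗ₜ etaP p q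
  | Gen.etaM => etaM p q ⊗ₜ 1 + deltaInv p q ⊗ₜ etaM p q
  | Gen.delta => delta p q ⊗ₜ delta p q
  | Gen.deltaInv => deltaInv p q ⊗ₜ deltaInv p q

theorem comulGen_rel {p : ℕ} {q : ℂ} (hp : Odd p) (hq : IsPrimitiveRoot q p)
    ⦃x y : FreeAlgebra ℂ Gen⦄ (h : Rel p q x y) :
    FreeAlgebra.lift ℂ (comulGen p q) x = FreeAlgebra.lift ℂ (comulGen p q) y := by
  have hq0 : q ^ 2 ≠ 0 := pow_ne_zero _ (hq.ne_zero hp.pos.ne')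
  have h2 := sq_primitive hp hq
  cases h with
  | eta_eta =>
    simp only [map_mul, map_smul, FreeAlgebra.lift_ι_apply, comulGen, add_mul, mul_add,
      Algebra.TensorProduct.tmul_mul_tmul, one_mul, mul_one, etaM_etaP, etaM_delta,
      deltaInv_etaP, delta_deltaInv, deltaInv_delta, TensorProduct.smul_tmul',
      TensorProduct.tmul_smul, smul_add]
    abel
  | etaP_delta =>
    simp only [map_mul, map_smul, FreeAlgebra.lift_ι_apply, comulGen, add_mul, mul_add,
      Algebra.TensorProduct.tmul_mul_tmul, one_mul, mul_one, etaP_delta,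
      TensorProduct.smul_tmul', TensorProduct.tmul_smul, smul_add]
  | etaM_delta =>
    simp only [map_mul, map_smul, FreeAlgebra.lift_ι_apply, comulGen, add_mul, mul_add,
      Algebra.TensorProduct.tmul_mul_tmul, one_mul, mul_one, etaM_delta, delta_deltaInv,
      deltaInv_delta, TensorProduct.smul_tmul', TensorProduct.tmul_smul, smul_add]
  | delta_inv =>
    simp only [map_mul, map_one, FreeAlgebra.lift_ι_apply, comulGen,
      Algebra.TensorProduct.tmul_mul_tmul, delta_deltaInv, Algebra.TensorProduct.one_def]
  | inv_delta =>
    simp only [map_mul, map_one, FreeAlgebra.lift_ι_apply, comulGen,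
      Algebra.TensorProduct.tmul_mul_tmul, deltaInv_delta, Algebra.TensorProduct.one_def]
  | delta_pow =>
    simp only [map_pow, map_one, FreeAlgebra.lift_ι_apply, comulGen,
      Algebra.TensorProduct.tmul_pow, delta_pow, Algebra.TensorProduct.one_def]
  | etaP_pow =>
    simp only [map_pow, map_zero, FreeAlgebra.lift_ι_apply, comulGen]
    refine add_pow_root (R := RedAlg p q ⊗[ℂ] RedAlg p q) hp.pos h2.inv
      (etaP p q ⊗ₜ 1) (delta p q ⊗ₜ etaP p q) ?_ ?_ ?_
    · simp only [Algebra.TensorProduct.tmul_mul_tmul, one_mul, mul_one, etaP_delta,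
        TensorProduct.smul_tmul', smul_smul, inv_mul_cancel₀ hq0, one_smul]
    · simp only [Algebra.TensorProduct.tmul_pow, etaP_pow, TensorProduct.zero_tmul]
    · simp only [Algebra.TensorProduct.tmul_pow, etaP_pow, TensorProduct.tmul_zero]
  | etaM_pow =>
    simp only [map_pow, map_zero, FreeAlgebra.lift_ι_apply, comulGen]
    refine add_pow_root (R := RedAlg p q ⊗[ℂ] RedAlg p q) hp.pos h2
      (etaM p q ⊗ₜ 1) (deltaInv p q ⊗ₜ etaM p q) ?_ ?_ ?_
    · simp only [Algebra.TensorProduct.tmul_mul_tmul, one_mul, mul_one, deltaInv_etaM,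
        TensorProduct.smul_tmul']
    · simp only [Algebra.TensorProduct.tmul_pow, etaM_pow, TensorProduct.zero_tmul]
    · simp only [Algebra.TensorProduct.tmul_pow, etaM_pow, TensorProduct.tmul_zero]

/-- The coproduct `Δ : A(E(1,1|p)) → A(E(1,1|p)) ⊗ A(E(1,1|p))`, an algebra homomorphism. -/
noncomputable def comul {p : ℕ} {q : ℂ} (hp : Odd p) (hq : IsPrimitiveRoot q p) :
    RedAlg p q →ₐ[ℂ] RedAlg p q ⊗[ℂ] RedAlg p q :=
  RingQuot.liftAlgHom ℂ ⟨FreeAlgebra.lift ℂ (comulGen p q), comulGen_rel hp hq⟩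

theorem comul_gen {p : ℕ} {q : ℂ} (hp : Odd p) (hq : IsPrimitiveRoot q p) (g : Gen) :
    comul hp hq (gen p q g) = comulGen p q g := by
  simp [comul, gen]

/-! ### The integral on `E(1,1|p)`

A function `v n m k` is read as the family of coefficients of a combination of the monomials
`η₊ⁿ η₋ᵐ δᵏ`, `n, m < p`, `k` modulo `p`; the generators act by left multiplication. -/

/-- Left multiplication by the generators on coefficient families. -/
noncomputable def repGen (p : ℕ) (q : ℂ) : Gen → Module.End ℂ (ℕ → ℕ → ZMod p → ℂ)
  | Gen.etaP =>
    { toFun := fun v n m k => if 0 < n ∧ n < p then v (n - 1) m k else 0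
      map_add' := fun v w => by
        funext n m k
        by_cases h : 0 < n ∧ n < p <;> simp [h]
      map_smul' := fun c v => by
        funext n m k
        by_cases h : 0 < n ∧ n < p <;> simp [h] }
  | Gen.etaM =>
    { toFun := fun v n m k => if 0 < m ∧ m < p then (q ^ 2) ^ n * v n (m - 1) k else 0
      map_add' := fun v w => by
        funext n m k
        by_cases h : 0 < m ∧ m < p <;> simp [h, mul_add]
      map_smul' := fun c v => by
        funext n m k
        by_cases h : 0 < m ∧ m < p <;> simp [h, mul_left_comm] }
  | Gen.delta =>
    { toFun := fun v n m k => ((q ^ 2) ^ (n + m))⁻¹ * v n m (k - 1)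
      map_add' := fun v w => by
        funext n m k
        simp [mul_add]
      map_smul' := fun c v => by
        funext n m k
        simp [mul_left_comm] }
  | Gen.deltaInv =>
    { toFun := fun v n m k => (q ^ 2) ^ (n + m) * v n m (k + 1)
      map_add' := fun v w => by
        funext n m k
        simp [mul_add]
      map_smul' := fun c v => by
        funext n m k
        simp [mul_left_comm] }

theorem repGen_etaP_pow (p : ℕ) (q : ℂ) (j : ℕ) (v : ℕ → ℕ → ZMod p → ℂ) (n m : ℕ)
    (k : ZMod p) : (repGen p q Gen.etaP ^ (j + 1)) v n m k
      = if j + 1 ≤ n ∧ n < p then v (n - (j + 1)) m k else 0 := by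
  induction j generalizing n with
  | zero =>
    rw [zero_add, pow_one]
    rfl
  | succ j ih =>
    rw [pow_succ', Module.End.mul_apply]
    change (if 0 < n ∧ n < p then (repGen p q Gen.etaP ^ (j + 1)) v (n - 1) m k else 0) = _
    rw [ih]
    by_cases h : j + 1 + 1 ≤ n ∧ n < p
    · rw [if_pos h, if_pos (by omega), if_pos (by omega),
        show n - 1 - (j + 1) = n - (j + 1 + 1) by omega]
    · rw [if_neg h]
      by_cases h' : 0 < n ∧ n < p
      · rw [if_pos h', if_neg (by omega)]
      · rw [if_neg h']

theorem repGen_etaM_pow (p : ℕ) (q : ℂ) (j : ℕ) (v : ℕ → ℕ → ZMod p → ℂ) (n m : ℕ)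
    (k : ZMod p) : (repGen p q Gen.etaM ^ (j + 1)) v n m k
      = if j + 1 ≤ m ∧ m < p then ((q ^ 2) ^ n) ^ (j + 1) * v n (m - (j + 1)) k else 0 := by
  induction j generalizing m with
  | zero =>
    rw [zero_add, pow_one, pow_one]
    rfl
  | succ j ih =>
    rw [pow_succ', Module.End.mul_apply]
    change (if 0 < m ∧ m < p then
      (q ^ 2) ^ n * (repGen p q Gen.etaM ^ (j + 1)) v n (m - 1) k else 0) = _
    rw [ih]
    by_cases h : j + 1 + 1 ≤ m ∧ m < p
    · rw [if_pos h, if_pos (by omega), if_pos (by omega),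
        show m - 1 - (j + 1) = m - (j + 1 + 1) by omega]
      ring
    · rw [if_neg h]
      by_cases h' : 0 < m ∧ m < p
      · rw [if_pos h', if_neg (by omega), mul_zero]
      · rw [if_neg h']

theorem repGen_delta_pow (p : ℕ) (q : ℂ) (j : ℕ) (v : ℕ → ℕ → ZMod p → ℂ) (n m : ℕ)
    (k : ZMod p) : (repGen p q Gen.delta ^ j) v n m k
      = (((q ^ 2) ^ (n + m))⁻¹) ^ j * v n m (k - j) := by
  induction j generalizing k with
  | zero => simp
  | succ j ih =>
    rw [pow_succ', Module.End.mul_apply]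
    change ((q ^ 2) ^ (n + m))⁻¹ * (repGen p q Gen.delta ^ j) v n m (k - 1) = _
    rw [ih, show k - 1 - (j : ZMod p) = k - ((j + 1 : ℕ) : ZMod p) by push_cast; ring]
    ring

theorem repGen_rel {p : ℕ} {q : ℂ} (hp : Odd p) (hq : IsPrimitiveRoot q p)
    ⦃x y : FreeAlgebra ℂ Gen⦄ (h : Rel p q x y) :
    FreeAlgebra.lift ℂ (repGen p q) x = FreeAlgebra.lift ℂ (repGen p q) y := by
  have hq0 : q ≠ 0 := hq.ne_zero hp.pos.ne'
  obtain ⟨r, hr⟩ : ∃ r, p = r + 1 := ⟨p - 1, by have := hp.pos; omega⟩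
  cases h with
  | eta_eta =>
    simp only [map_mul, map_smul, FreeAlgebra.lift_ι_apply]
    ext v n m k
    simp only [Module.End.mul_apply, LinearMap.smul_apply, Pi.smul_apply, smul_eq_mul]
    change (if 0 < m ∧ m < p then
        (q ^ 2) ^ n * (if 0 < n ∧ n < p then v (n - 1) (m - 1) k else 0) else 0)
      = q ^ 2 * (if 0 < n ∧ n < p then
          (if 0 < m ∧ m < p then (q ^ 2) ^ (n - 1) * v (n - 1) (m - 1) k else 0) else 0)
    by_cases h1 : 0 < m ∧ m < p <;> by_cases h2 : 0 < n ∧ n < p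
    · obtain ⟨n, rfl⟩ : ∃ i, n = i + 1 := ⟨n - 1, by omega⟩
      simp only [h1, h2, and_self, if_true, Nat.add_sub_cancel]
      ring
    all_goals simp [h1, h2]
  | etaP_delta =>
    simp only [map_mul, map_smul, FreeAlgebra.lift_ι_apply]
    ext v n m k
    simp only [Module.End.mul_apply, LinearMap.smul_apply, Pi.smul_apply, smul_eq_mul]
    change (if 0 < n ∧ n < p then ((q ^ 2) ^ (n - 1 + m))⁻¹ * v (n - 1) m (k - 1) else 0)
      = q ^ 2 * (((q ^ 2) ^ (n + m))⁻¹ * (if 0 < n ∧ n < p then v (n - 1) m (k - 1) else 0))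
    by_cases h2 : 0 < n ∧ n < p
    · obtain ⟨n, rfl⟩ : ∃ i, n = i + 1 := ⟨n - 1, by omega⟩
      simp only [h2, and_self, if_true, Nat.add_sub_cancel]
      rw [show n + 1 + m = (n + m) + 1 by omega]
      field_simp
      ring
    · simp [h2]
  | etaM_delta =>
    simp only [map_mul, map_smul, FreeAlgebra.lift_ι_apply]
    ext v n m k
    simp only [Module.End.mul_apply, LinearMap.smul_apply, Pi.smul_apply, smul_eq_mul]
    change (if 0 < m ∧ m < p then
        (q ^ 2) ^ n * (((q ^ 2) ^ (n + (m - 1)))⁻¹ * v n (m - 1) (k - 1)) else 0)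
      = q ^ 2 * (((q ^ 2) ^ (n + m))⁻¹ *
          (if 0 < m ∧ m < p then (q ^ 2) ^ n * v n (m - 1) (k - 1) else 0))
    by_cases h2 : 0 < m ∧ m < p
    · obtain ⟨m, rfl⟩ : ∃ i, m = i + 1 := ⟨m - 1, by omega⟩
      simp only [h2, and_self, if_true, Nat.add_sub_cancel]
      rw [show n + (m + 1) = (n + m) + 1 by omega]
      field_simp
      ring
    · simp [h2]
  | delta_inv =>
    simp only [map_mul, map_one, FreeAlgebra.lift_ι_apply]
    ext v n m k
    simp only [Module.End.mul_apply, Module.End.one_apply]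
    change ((q ^ 2) ^ (n + m))⁻¹ * ((q ^ 2) ^ (n + m) * v n m (k - 1 + 1)) = v n m k
    rw [sub_add_cancel, inv_mul_cancel_left₀ (pow_ne_zero _ (pow_ne_zero _ hq0))]
  | inv_delta =>
    simp only [map_mul, map_one, FreeAlgebra.lift_ι_apply]
    ext v n m k
    simp only [Module.End.mul_apply, Module.End.one_apply]
    change (q ^ 2) ^ (n + m) * (((q ^ 2) ^ (n + m))⁻¹ * v n m (k + 1 - 1)) = v n m k
    rw [add_sub_cancel_right, mul_inv_cancel_left₀ (pow_ne_zero _ (pow_ne_zero _ hq0))]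
  | delta_pow =>
    simp only [map_pow, map_one, FreeAlgebra.lift_ι_apply]
    ext v n m k
    rw [repGen_delta_pow, Module.End.one_apply, ZMod.natCast_self, sub_zero, inv_pow,
      ← pow_mul, ← pow_mul, show 2 * ((n + m) * p) = p * (2 * (n + m)) by ring, pow_mul,
      hq.pow_eq_one, one_pow, inv_one, one_mul]
  | etaP_pow =>
    simp only [map_pow, map_zero, FreeAlgebra.lift_ι_apply]
    ext v n m k
    have := repGen_etaP_pow p q r v n m k
    rw [← hr, if_neg (by omega)] at this
    exact this
  | etaM_pow =>
    simp only [map_pow, map_zero, FreeAlgebra.lift_ι_apply]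
    ext v n m k
    have := repGen_etaM_pow p q r v n m k
    rw [← hr, if_neg (by omega)] at this
    exact this

/-- The left regular representation of `A(E(1,1|p))` on coefficient families. -/
noncomputable def rep {p : ℕ} {q : ℂ} (hp : Odd p) (hq : IsPrimitiveRoot q p) :
    RedAlg p q →ₐ[ℂ] Module.End ℂ (ℕ → ℕ → ZMod p → ℂ) :=
  RingQuot.liftAlgHom ℂ ⟨FreeAlgebra.lift ℂ (repGen p q), repGen_rel hp hq⟩

theorem rep_gen {p : ℕ} {q : ℂ} (hp : Odd p) (hq : IsPrimitiveRoot q p) (g : Gen) :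
    rep hp hq (gen p q g) = repGen p q g := by
  simp [rep, gen]

/-- The coefficient family of the unit `η₊⁰ η₋⁰ δ⁰`. -/
noncomputable def unitCoeff (p : ℕ) : ℕ → ℕ → ZMod p → ℂ :=
  fun n m k => if n = 0 ∧ m = 0 ∧ k = 0 then 1 else 0

/-- The functional `ℐ` on `A(E(1,1|p))`: `q⁻¹` times the coefficient of `η₊^{p-1} η₋^{p-1}`.
Its values on monomials are computed in `redIntegral_monomial`. -/
noncomputable def redIntegral {p : ℕ} {q : ℂ} (hp : Odd p) (hq : IsPrimitiveRoot q p) :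
    RedAlg p q →ₗ[ℂ] ℂ where
  toFun a := q⁻¹ * rep hp hq a (unitCoeff p) (p - 1) (p - 1) 0
  map_add' a b := by simp [mul_add]
  map_smul' c a := by simp [mul_left_comm]

theorem rep_monomial {p : ℕ} {q : ℂ} (hp : Odd p) (hq : IsPrimitiveRoot q p)
    (n m k : ℕ) (hn : n < p) (hm : m < p) (a b : ℕ) (c : ZMod p) (ha : a < p) (hb : b < p) :
    rep hp hq (etaP p q ^ n * etaM p q ^ m * delta p q ^ k) (unitCoeff p) a b c
      = if a = n ∧ b = m ∧ c = (k : ZMod p) then 1 else 0 := by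
  have hd : ∀ (a b : ℕ) (c : ZMod p), (repGen p q Gen.delta ^ k) (unitCoeff p) a b c
      = if a = 0 ∧ b = 0 ∧ c = (k : ZMod p) then 1 else 0 := by
    intro a b c
    rw [repGen_delta_pow]
    by_cases h : a = 0 ∧ b = 0 ∧ c = (k : ZMod p)
    · obtain ⟨rfl, rfl, rfl⟩ := h
      simp [unitCoeff]
    · have h' : ¬ (a = 0 ∧ b = 0 ∧ c - (k : ZMod p) = 0) := by rwa [sub_eq_zero]
      rw [if_neg h, unitCoeff, if_neg h', mul_zero]
  have hM : ∀ (a b : ℕ) (c : ZMod p), b < p →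
      (repGen p q Gen.etaM ^ m) ((repGen p q Gen.delta ^ k) (unitCoeff p)) a b c
      = if a = 0 ∧ b = m ∧ c = (k : ZMod p) then 1 else 0 := by
    intro a b c hb
    rcases m with _ | j
    · rw [pow_zero, Module.End.one_apply, hd]
    · rw [repGen_etaM_pow, hd]
      by_cases h : a = 0 ∧ b = j + 1 ∧ c = (k : ZMod p)
      · obtain ⟨rfl, rfl, rfl⟩ := h
        simp [hb]
      · rw [if_neg h]
        by_cases h1 : j + 1 ≤ b ∧ b < p
        · have h2 : ¬ (a = 0 ∧ b - (j + 1) = 0 ∧ c = (k : ZMod p)) := by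
            rintro ⟨h3, h4, h5⟩
            exact h ⟨h3, by omega, h5⟩
          rw [if_pos h1, if_neg h2, mul_zero]
        · rw [if_neg h1]
  simp only [map_mul, map_pow, etaP, etaM, delta, rep_gen, Module.End.mul_apply]
  rcases n with _ | j
  · rw [pow_zero, Module.End.one_apply, hM a b c hb]
  · rw [repGen_etaP_pow, hM _ b c hb]
    by_cases h : a = j + 1 ∧ b = m ∧ c = (k : ZMod p)
    · obtain ⟨rfl, rfl, rfl⟩ := h
      simp [ha]
    · rw [if_neg h]
      by_cases h1 : j + 1 ≤ a ∧ a < p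
      · have h2 : ¬ (a - (j + 1) = 0 ∧ b = m ∧ c = (k : ZMod p)) := by
          rintro ⟨h3, h4, h5⟩
          exact h ⟨by omega, h4, h5⟩
        rw [if_pos h1, if_neg h2]
      · rw [if_neg h1]

/-- `ℐ(η₊ⁿ η₋ᵐ δᵏ) = q⁻¹ δ_{n,p-1} δ_{m,p-1} δ_{k,0 (mod p)}` for `n, m ∈ [0, p-1]`. -/
theorem redIntegral_monomial {p : ℕ} {q : ℂ} (hp : Odd p) (hq : IsPrimitiveRoot q p)
    (n m k : ℕ) (hn : n < p) (hm : m < p) :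
    redIntegral hp hq (etaP p q ^ n * etaM p q ^ m * delta p q ^ k)
      = if n = p - 1 ∧ m = p - 1 ∧ p ∣ k then q⁻¹ else 0 := by
  have hpp := hp.pos
  change q⁻¹ * rep hp hq _ (unitCoeff p) (p - 1) (p - 1) 0 = _
  rw [rep_monomial hp hq n m k hn hm _ _ _ (by omega) (by omega)]
  have e : (p - 1 = n ∧ p - 1 = m ∧ (0 : ZMod p) = (k : ZMod p))
      ↔ (n = p - 1 ∧ m = p - 1 ∧ p ∣ k) := by
    rw [eq_comm (a := (0 : ZMod p)), ZMod.natCast_eq_zero_iff, eq_comm (a := p - 1) (b := n),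
      eq_comm (a := p - 1) (b := m)]
  by_cases h : n = p - 1 ∧ m = p - 1 ∧ p ∣ k
  · rw [if_pos (e.mpr h), if_pos h, mul_one]
  · rw [if_neg (fun h' => h (e.mp h')), if_neg h, mul_zero]

/-! ## Functions on the translation group `ℝ²` -/

/-- `C₀^∞(ℝ²)`: complex valued, infinitely differentiable, compactly supported functions of
`z = (z₊, z₋)`. -/
def TestFn : Submodule ℂ (ℝ × ℝ → ℂ) where
  carrier := {f | ContDiff ℝ ∞ f ∧ HasCompactSupport f}
  zero_mem' := ⟨contDiff_const, HasCompactSupport.zero⟩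
  add_mem' hf hg := ⟨hf.1.add hg.1, hf.2.add hg.2⟩
  smul_mem' c _ hf := ⟨contDiff_const.smul hf.1, hf.2.smul_left (f := fun _ => c)⟩

/-- Smooth functions `g(x, y)` on `ℝ² × ℝ²` such that `g(x, ·)` and `g(·, y)` are compactly
supported for all fixed `x` and `y`. -/
def TwoPointFn : Submodule ℂ ((ℝ × ℝ) × (ℝ × ℝ) → ℂ) where
  carrier := {g | ContDiff ℝ ∞ g ∧ (∀ x, HasCompactSupport fun y => g (x, y)) ∧
    ∀ y, HasCompactSupport fun x => g (x, y)}
  zero_mem' := ⟨contDiff_const, fun _ => HasCompactSupport.zero, fun _ => HasCompactSupport.zero⟩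
  add_mem' hf hg := ⟨hf.1.add hg.1, fun x => (hf.2.1 x).add (hg.2.1 x),
    fun y => (hf.2.2 y).add (hg.2.2 y)⟩
  smul_mem' c _ hf := ⟨contDiff_const.smul hf.1,
    fun x => (hf.2.1 x).smul_left (f := fun _ => c),
    fun y => (hf.2.2 y).smul_left (f := fun _ => c)⟩

/-- The derivative of a test function in the constant direction `v`. -/
noncomputable def dirDeriv (v : ℝ × ℝ) : TestFn →ₗ[ℂ] TestFn where
  toFun f := ⟨fun z => fderiv ℝ (f : ℝ × ℝ → ℂ) z v,
    (f.2.1.fderiv_right (m := ∞) (by simp)).clm_apply contDiff_const,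
    f.2.2.fderiv_apply (𝕜 := ℝ) v⟩
  map_add' f g := by
    ext z
    change fderiv ℝ ((f : ℝ × ℝ → ℂ) + (g : ℝ × ℝ → ℂ)) z v = _
    rw [fderiv_add (f.2.1.differentiable (by simp) z) (g.2.1.differentiable (by simp) z)]
    rfl
  map_smul' c f := by
    ext z
    change fderiv ℝ (c • (f : ℝ × ℝ → ℂ)) z v = _
    rw [fderiv_const_smul (f.2.1.differentiable (by simp) z)]
    rfl

/-- `∂/∂z₊` -/
noncomputable def dP : TestFn →ₗ[ℂ] TestFn := dirDeriv (1, 0)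

/-- `∂/∂z₋` -/
noncomputable def dM : TestFn →ₗ[ℂ] TestFn := dirDeriv (0, 1)

theorem translate_right {f : ℝ × ℝ → ℂ} (hf : HasCompactSupport f) (x : ℝ × ℝ) :
    HasCompactSupport fun y => f (x + y) :=
  hf.comp_homeomorph (Homeomorph.addLeft x)

theorem translate_left {f : ℝ × ℝ → ℂ} (hf : HasCompactSupport f) (y : ℝ × ℝ) :
    HasCompactSupport fun x => f (x + y) :=
  hf.comp_homeomorph (Homeomorph.addRight y)

/-- `f ↦ f(Z)` with `Z = z ⊗ 1 + 1 ⊗ z`, that is, the function `(x, y) ↦ f(x + y)`. -/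
def atZ : TestFn →ₗ[ℂ] TwoPointFn where
  toFun f := ⟨fun w => (f : ℝ × ℝ → ℂ) (w.1 + w.2), f.2.1.comp (contDiff_fst.add contDiff_snd),
    fun x => translate_right f.2.2 x, fun y => translate_left f.2.2 y⟩
  map_add' _ _ := rfl
  map_smul' _ _ := rfl

/-- `g ↦ g(x, ·)` -/
def restrictFst (x : ℝ × ℝ) : TwoPointFn →ₗ[ℂ] TestFn where
  toFun g := ⟨fun y => (g : (ℝ × ℝ) × (ℝ × ℝ) → ℂ) (x, y),
    g.2.1.comp (contDiff_const.prodMk contDiff_id), g.2.2.1 x⟩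
  map_add' _ _ := rfl
  map_smul' _ _ := rfl

/-- `g ↦ g(·, y)` -/
def restrictSnd (y : ℝ × ℝ) : TwoPointFn →ₗ[ℂ] TestFn where
  toFun g := ⟨fun x => (g : (ℝ × ℝ) × (ℝ × ℝ) → ℂ) (x, y),
    g.2.1.comp (contDiff_id.prodMk contDiff_const), g.2.2.2 y⟩
  map_add' _ _ := rfl
  map_smul' _ _ := rfl

theorem integrable_testFn (f : TestFn) :
    MeasureTheory.Integrable (f : ℝ × ℝ → ℂ) MeasureTheory.volume :=
  f.2.1.continuous.integrable_of_hasCompactSupport f.2.2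

/-- `ℐ_C(f) = ∫∫ f(z₊, z₋) dz₊ dz₋`. -/
noncomputable def planeIntegral : TestFn →ₗ[ℂ] ℂ where
  toFun f := ∫ z : ℝ × ℝ, (f : ℝ × ℝ → ℂ) z
  map_add' f g := MeasureTheory.integral_add (integrable_testFn f) (integrable_testFn g)
  map_smul' c f := MeasureTheory.integral_const_mul c (f : ℝ × ℝ → ℂ)

/-! ## The quantum Poincaré group `E_q(1,1)` -/

/-- `A₀(E_q(1,1))`: finite sums `∑ aₙ fₙ` with `aₙ ∈ A(E(1,1|p))` and `fₙ ∈ C₀^∞(ℝ²)`. -/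
abbrev CompactAlg (p : ℕ) (q : ℂ) : Type := RedAlg p q ⊗[ℂ] TestFn

/-- `B₊` -/
noncomputable def BP (p : ℕ) (q : ℂ) : RedAlg p q ⊗[ℂ] RedAlg p q :=
  ((-1 : ℂ) ^ ((p + 1) / 2)) • ∑ n ∈ Finset.Ico 1 p,
    (q ^ (n ^ 2) / (qFact q (p - n) * qFact q n)) •
      ((etaP p q ^ (p - n) * delta p q ^ n) ⊗ₜ[ℂ] (etaP p q ^ n))

/-- `B₋` -/
noncomputable def BM (p : ℕ) (q : ℂ) : RedAlg p q ⊗[ℂ] RedAlg p q :=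
  ((-1 : ℂ) ^ ((p + 1) / 2)) • ∑ n ∈ Finset.Ico 1 p,
    ((q ^ (n ^ 2))⁻¹ / (qFact q (p - n) * qFact q n)) •
      ((etaM p q ^ (p - n) * deltaInv p q ^ n) ⊗ₜ[ℂ] (etaM p q ^ n))

/-- The map `a f ↦ Δ(a) b h(Z)`, where `h = D f`. -/
noncomputable def comulTerm {p : ℕ} {q : ℂ} (hp : Odd p) (hq : IsPrimitiveRoot q p)
    (b : RedAlg p q ⊗[ℂ] RedAlg p q) (D : TestFn →ₗ[ℂ] TestFn) :
    CompactAlg p q →ₗ[ℂ] (RedAlg p q ⊗[ℂ] RedAlg p q) ⊗[ℂ] TwoPointFn :=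
  TensorProduct.map (LinearMap.mulRight ℂ b ∘ₗ (comul hp hq).toLinearMap) (atZ ∘ₗ D)

/-- The coproduct of `E_q(1,1)` on `A₀(E_q(1,1))`: `Δ(a f) = Δ(a) Δ(f)` with
`Δ(f) = f(Z) + (∂₊f)(Z) B₊ + (∂₋f)(Z) B₋ + (∂₊∂₋f)(Z) B₊B₋`. -/
noncomputable def comulE {p : ℕ} {q : ℂ} (hp : Odd p) (hq : IsPrimitiveRoot q p) :
    CompactAlg p q →ₗ[ℂ] (RedAlg p q ⊗[ℂ] RedAlg p q) ⊗[ℂ] TwoPointFn :=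
  comulTerm hp hq 1 LinearMap.id + comulTerm hp hq (BP p q) dP + comulTerm hp hq (BM p q) dM
    + comulTerm hp hq (BP p q * BM p q) (dP ∘ₗ dM)

/-- `(id ⊗ J)`, evaluated at the point `x` of the first copy of `ℝ²`: it sends
`(a ⊗ b) g` to `J(b g(x, ·)) a`. -/
noncomputable def sliceRight {p : ℕ} {q : ℂ} (J : CompactAlg p q →ₗ[ℂ] ℂ) (x : ℝ × ℝ) :
    (RedAlg p q ⊗[ℂ] RedAlg p q) ⊗[ℂ] TwoPointFn →ₗ[ℂ] RedAlg p q :=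
  (TensorProduct.rid ℂ (RedAlg p q)).toLinearMap
    ∘ₗ TensorProduct.map LinearMap.id J
    ∘ₗ (TensorProduct.assoc ℂ (RedAlg p q) (RedAlg p q) TestFn).toLinearMap
    ∘ₗ TensorProduct.map LinearMap.id (restrictFst x)

/-- `(J ⊗ id)`, evaluated at the point `y` of the second copy of `ℝ²`: it sends
`(a ⊗ b) g` to `J(a g(·, y)) b`. -/
noncomputable def sliceLeft {p : ℕ} {q : ℂ} (J : CompactAlg p q →ₗ[ℂ] ℂ) (y : ℝ × ℝ) :
    (RedAlg p q ⊗[ℂ] RedAlg p q) ⊗[ℂ] TwoPointFn →ₗ[ℂ] RedAlg p q :=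
  (TensorProduct.rid ℂ (RedAlg p q)).toLinearMap
    ∘ₗ TensorProduct.map LinearMap.id J
    ∘ₗ (TensorProduct.assoc ℂ (RedAlg p q) (RedAlg p q) TestFn).toLinearMap
    ∘ₗ TensorProduct.map (TensorProduct.comm ℂ (RedAlg p q) (RedAlg p q)).toLinearMap
      (restrictSnd y)

theorem sliceRight_tmul {p : ℕ} {q : ℂ} (J : CompactAlg p q →ₗ[ℂ] ℂ) (x : ℝ × ℝ)
    (a b : RedAlg p q) (g : TwoPointFn) :
    sliceRight J x ((a ⊗ₜ b) ⊗ₜ g) = J (b ⊗ₜ restrictFst x g) • a := by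
  simp [sliceRight]

theorem sliceLeft_tmul {p : ℕ} {q : ℂ} (J : CompactAlg p q →ₗ[ℂ] ℂ) (y : ℝ × ℝ)
    (a b : RedAlg p q) (g : TwoPointFn) :
    sliceLeft J y ((a ⊗ₜ b) ⊗ₜ g) = J (a ⊗ₜ restrictSnd y g) • b := by
  simp [sliceLeft]

/-- A linear functional `J` on `A₀(E_q(1,1))` is an invariant integral of `E_q(1,1)` if
`(id ⊗ J)Δ(F) = J(F) 1` and `(J ⊗ id)Δ(F) = J(F) 1` for all `F`. Elements of
`A(E(1,1|p)) ⊗ C^∞(ℝ²)` are compared as `A(E(1,1|p))`-valued functions on `ℝ²`. -/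
structure IsInvariantIntegral {p : ℕ} {q : ℂ} (hp : Odd p) (hq : IsPrimitiveRoot q p)
    (J : CompactAlg p q →ₗ[ℂ] ℂ) : Prop where
  left_invariant : ∀ (F : CompactAlg p q) (x : ℝ × ℝ),
    sliceRight J x (comulE hp hq F) = J F • (1 : RedAlg p q)
  right_invariant : ∀ (F : CompactAlg p q) (y : ℝ × ℝ),
    sliceLeft J y (comulE hp hq F) = J F • (1 : RedAlg p q)

/-- `ℐ_E(∑ aₙ fₙ) = ∑ ℐ(aₙ) ℐ_C(fₙ)`. -/
noncomputable def integralE {p : ℕ} {q : ℂ} (hp : Odd p) (hq : IsPrimitiveRoot q p) :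
    CompactAlg p q →ₗ[ℂ] ℂ :=
  LinearMap.mul' ℂ ℂ ∘ₗ TensorProduct.map (redIntegral hp hq) planeIntegral

end QPoincare

/-!
Invariance of `ℐ_E` splits into three facts. The functional `ℐ` is a two-sided Haar functional of
`A(E(1,1|p))`, which is read off from the q-binomial expansion of `Δ(η₊ⁿ η₋ᵐ δᵏ)`
(`redIntegral_left_invariant`, `redIntegral_right_invariant`); Lebesgue measure is translation
invariant; and the integral of a derivative of a test function vanishes, so that the terms of
`Δ(f)` with `B₊`, `B₋` and `B₊B₋` contribute nothing.

For uniqueness, left invariance at the single point `x = 0` is enough. The equation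
`(id ⊗ J)Δ(a f) = J(a f) 1` is tested against the matrix entries of two-dimensional representations
`jet s t` of `A(E(1,1|p))`, in which `η₊` and `η₋` act by `s` and `t` times the elementary nilpotent
matrix and `δ` by `diag(1, q²)`: they see only the part of the first tensor factor of degree at most
one in the `η`s. All terms of `B₊` and `B₋` except `η_± δ^{±(p-1)} ⊗ η_±^{p-1}` become zero there.
Comparing entries for `a` a monomial gives the following.

* The off-diagonal entry yields `J(η₊ⁿ η₋ᵐ δᵏ f) = 0` whenever `n < p - 1` or `m < p - 1`
  (`invariant_etaP_lower`, `invariant_etaM_lower`), as the q-numbers that occur as coefficients are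
  nonzero.
* The lower diagonal entry yields `q²ᵏ J(η₊^{p-1} η₋^{p-1} δᵏ f) = J(η₊^{p-1} η₋^{p-1} δᵏ f)`, hence
  zero for `p ∤ k` (`invariant_top`).
* The off-diagonal entry for `a = η₋^{p-1}` and `a = η₊^{p-1}` isolates the terms with derivatives:
  the linear form `L(f) = J(η₊^{p-1} η₋^{p-1} f)` annihilates `∂₊g` and `∂₋g` for every test function
  `g` (`invariant_dP`, `invariant_dM`).

A test function whose integral over the plane vanishes is of the form `∂₊g + ∂₋h`, so `L` is a
multiple of the integral (`eq_smul_planeIntegral`). No continuity of `J` is needed. Since the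
monomials span `A(E(1,1|p))` (`span_monomial`), `J` is a multiple of `ℐ_E`.
-/

namespace QPoincare

/-! ### Test functions on the plane -/

section TestFunctions

open MeasureTheory Set

theorem testFn_vanishes (f : TestFn) : ∃ R : ℝ, ∀ x y : ℝ, R < |x| ∨ R < |y| →
    (f : ℝ × ℝ → ℂ) (x, y) = 0 := by
  obtain ⟨R, hR⟩ := f.2.2.isCompact.isBounded.subset_closedBall (0 : ℝ × ℝ)
  refine ⟨R, fun x y h => ?_⟩
  by_contra h0
  have h1 := hR (subset_tsupport _ (Function.mem_support.mpr h0))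
  rw [mem_closedBall_zero_iff, Prod.norm_def] at h1
  have h2 := max_le_iff.mp h1
  simp only [Real.norm_eq_abs] at h2
  rcases h with h | h <;> linarith [h2.1, h2.2]

theorem hasCompactSupport_of_vanishes {g : ℝ × ℝ → ℂ} {R : ℝ}
    (h : ∀ x y : ℝ, R < |x| ∨ R < |y| → g (x, y) = 0) : HasCompactSupport g := by
  refine HasCompactSupport.intro (isCompact_closedBall (0 : ℝ × ℝ) R) fun z hz => ?_
  refine h z.1 z.2 ?_
  rw [mem_closedBall_zero_iff, Prod.norm_def, max_le_iff, not_and_or] at hz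
  simpa only [Real.norm_eq_abs, not_le] using hz

theorem slice_contDiff (f : TestFn) (y : ℝ) : ContDiff ℝ ∞ fun x => (f : ℝ × ℝ → ℂ) (x, y) :=
  f.2.1.comp (contDiff_id.prodMk contDiff_const)

theorem slice_hasCompactSupport (f : TestFn) (y : ℝ) :
    HasCompactSupport fun x => (f : ℝ × ℝ → ℂ) (x, y) := by
  obtain ⟨R, hR⟩ := testFn_vanishes f
  refine HasCompactSupport.intro (isCompact_closedBall (0 : ℝ) R) fun x hx => hR x y (Or.inl ?_)
  simpa [mem_closedBall_zero_iff] using hx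

/-- Smoothness of the convolution of `f` in the first variable with a measure `μ`, the second
variable being a parameter. Lebesgue measure gives the marginals of `f`, and its restriction to
`(0, ∞)` the primitive of `f` in the first variable. -/
theorem contDiff_slice_integral (f : TestFn) (μ : Measure ℝ) [IsLocallyFiniteMeasure μ] :
    ContDiff ℝ ∞ fun z : ℝ × ℝ => ∫ t, (f : ℝ × ℝ → ℂ) (z.1 - t, z.2) ∂μ := by
  obtain ⟨R, hR⟩ := testFn_vanishes f
  have h := contDiffOn_convolution_right_with_param (𝕜 := ℝ) (μ := μ) (n := ⊤)
    (ContinuousLinearMap.lsmul ℝ ℝ : ℝ →L[ℝ] ℂ →L[ℝ] ℂ) (f := fun _ : ℝ => (1 : ℝ))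
    (g := fun y x : ℝ => (f : ℝ × ℝ → ℂ) (x, y)) (s := univ) isOpen_univ
    (isCompact_closedBall (0 : ℝ) R)
    (fun y x _ hx => hR x y (Or.inl (by simpa [mem_closedBall_zero_iff] using hx)))
    (locallyIntegrable_const _)
    (f.2.1.comp (contDiff_snd.prodMk contDiff_fst)).contDiffOn
  rw [univ_prod_univ, contDiffOn_univ] at h
  have h2 := h.comp (contDiff_snd.prodMk contDiff_fst : ContDiff ℝ ∞ fun z : ℝ × ℝ => (z.2, z.1))
  convert h2 using 2 with z
  simp [convolution]

/-- A test function with zero integral along every line `z₋ = const` is `∂₊g` for a test function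
`g`, namely for its primitive, which is compactly supported by the condition on the integrals. -/
theorem exists_dP_eq (f : TestFn) (hf : ∀ y, ∫ x, (f : ℝ × ℝ → ℂ) (x, y) = 0) :
    ∃ g : TestFn, dP g = f := by
  obtain ⟨R, hR⟩ := testFn_vanishes f
  have hG := contDiff_slice_integral f (volume.restrict (Ioi 0))
  set G : ℝ × ℝ → ℂ := fun z => ∫ t in Ioi (0 : ℝ), (f : ℝ × ℝ → ℂ) (z.1 - t, z.2) with hGdef
  have hsupp : HasCompactSupport G := by
    refine hasCompactSupport_of_vanishes (R := R) fun x y h => ?_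
    rcases h with h | h
    · rcases lt_abs.mp h with hx | hx
      · -- To the right of the support, the primitive is the integral over the whole line.
        have e : ∫ t in Ioi (0 : ℝ), (f : ℝ × ℝ → ℂ) (x - t, y)
            = ∫ t, (f : ℝ × ℝ → ℂ) (x - t, y) := by
          refine setIntegral_eq_integral_of_forall_compl_eq_zero fun t ht => ?_
          have ht' : t ≤ 0 := not_lt.mp ht
          exact hR _ _ (Or.inl (lt_of_lt_of_le (by linarith) (le_abs_self _)))
        rw [hGdef]
        simp only
        rw [e, integral_sub_left_eq_self (fun s => (f : ℝ × ℝ → ℂ) (s, y)), hf y]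
      · refine setIntegral_eq_zero_of_forall_eq_zero fun t ht => ?_
        have ht' : 0 < t := ht
        exact hR _ _ (Or.inl (lt_of_lt_of_le (by linarith) (neg_le_abs _)))
    · exact setIntegral_eq_zero_of_forall_eq_zero fun t _ => hR _ _ (Or.inr h)
  refine ⟨⟨G, hG, hsupp⟩, ?_⟩
  ext ⟨x, y⟩
  change fderiv ℝ G (x, y) (1, 0) = _
  have h1 : HasDerivAt (fun s => G (s, y)) (fderiv ℝ G (x, y) (1, 0)) x := by
    have hd := (hG.differentiable (by simp) (x, y)).hasFDerivAt
    exact hd.comp_hasDerivAt x ((hasDerivAt_id x).prodMk (hasDerivAt_const x y))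
  have hc1 : ContDiff ℝ 1 fun s => (f : ℝ × ℝ → ℂ) (s, y) :=
    (slice_contDiff f y).of_le (by simp)
  have hconv : ∀ (h : ℝ → ℂ) (s : ℝ), convolution ((Ioi (0 : ℝ)).indicator fun _ => (1 : ℝ)) h
      (ContinuousLinearMap.lsmul ℝ ℝ : ℝ →L[ℝ] ℂ →L[ℝ] ℂ) volume s
      = ∫ t in Ioi (0 : ℝ), h (s - t) := by
    intro h s
    rw [← integral_indicator measurableSet_Ioi]
    refine integral_congr_ae (Filter.Eventually.of_forall fun t => ?_)
    by_cases ht : t ∈ Ioi (0 : ℝ) <;> simp [ht]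
  have h2 := (slice_hasCompactSupport f y).hasDerivAt_convolution_right (μ := volume)
    (ContinuousLinearMap.lsmul ℝ ℝ : ℝ →L[ℝ] ℂ →L[ℝ] ℂ)
    ((locallyIntegrable_const (1 : ℝ)).indicator (measurableSet_Ioi (a := (0 : ℝ)))) hc1 x
  rw [hconv] at h2
  have h3 : HasDerivAt (fun s => G (s, y))
      (∫ t in Ioi (0 : ℝ), deriv (fun s => (f : ℝ × ℝ → ℂ) (s, y)) (x - t)) x := by
    have e : (fun s => G (s, y)) = convolution ((Ioi (0 : ℝ)).indicator fun _ => (1 : ℝ))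
        (fun s => (f : ℝ × ℝ → ℂ) (s, y))
        (ContinuousLinearMap.lsmul ℝ ℝ : ℝ →L[ℝ] ℂ →L[ℝ] ℂ) volume := by
      funext s
      exact (hconv (fun u => (f : ℝ × ℝ → ℂ) (u, y)) s).symm
    rwa [e]
  rw [h1.unique h3]
  have h4 := HasCompactSupport.integral_Ioi_deriv_eq
    (f := fun t => (f : ℝ × ℝ → ℂ) (x - t, y))
    (hc1.comp (contDiff_const.sub contDiff_id))
    ((slice_hasCompactSupport f y).comp_homeomorph (Homeomorph.subLeft x)) 0
  have h5 : (deriv fun t => (f : ℝ × ℝ → ℂ) (x - t, y))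
      = fun t => - deriv (fun s => (f : ℝ × ℝ → ℂ) (s, y)) (x - t) := by
    funext t
    exact deriv_comp_const_sub (f := fun s => (f : ℝ × ℝ → ℂ) (s, y)) x t
  rw [h5, integral_neg, neg_inj] at h4
  rw [h4, sub_zero]

/-- The reflection `f(z₊, z₋) ↦ f(z₋, z₊)`. -/
noncomputable def swapFn (f : TestFn) : TestFn :=
  ⟨fun z => (f : ℝ × ℝ → ℂ) (z.2, z.1), f.2.1.comp (contDiff_snd.prodMk contDiff_fst),
    f.2.2.comp_homeomorph (Homeomorph.prodComm ℝ ℝ)⟩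

theorem dM_swapFn (f : TestFn) : dM (swapFn f) = swapFn (dP f) := by
  ext ⟨x, y⟩
  have hd := (f.2.1.differentiable (by simp) (y, x)).hasFDerivAt
  have hs : HasFDerivAt (fun z : ℝ × ℝ => (z.2, z.1)) ((ContinuousLinearMap.snd ℝ ℝ ℝ).prod
      (ContinuousLinearMap.fst ℝ ℝ ℝ)) (x, y) :=
    hasFDerivAt_snd.prodMk hasFDerivAt_fst
  have h := (hd.comp (x, y) hs).fderiv
  change fderiv ℝ ((f : ℝ × ℝ → ℂ) ∘ fun z : ℝ × ℝ => (z.2, z.1)) (x, y) (0, 1)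
    = fderiv ℝ (f : ℝ × ℝ → ℂ) (y, x) (1, 0)
  rw [h]
  simp

theorem exists_dM_eq (f : TestFn) (hf : ∀ x, ∫ y, (f : ℝ × ℝ → ℂ) (x, y) = 0) :
    ∃ g : TestFn, dM g = f := by
  obtain ⟨g, hg⟩ := exists_dP_eq (swapFn f) hf
  refine ⟨swapFn g, ?_⟩
  rw [dM_swapFn, hg]
  rfl

theorem planeIntegral_dirDeriv (v : ℝ × ℝ) (f : TestFn) : planeIntegral (dirDeriv v f) = 0 := by
  have h := integral_bilinear_hasFDerivAt_right_eq_neg_left_of_integrable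
    (μ := (volume : Measure (ℝ × ℝ))) (v := v)
    (f := fun _ : ℝ × ℝ => (1 : ℝ)) (f' := 0) (g := (f : ℝ × ℝ → ℂ))
    (g' := fderiv ℝ (f : ℝ × ℝ → ℂ))
    (B := (ContinuousLinearMap.lsmul ℝ ℝ : ℝ →L[ℝ] ℂ →L[ℝ] ℂ))
    (by simp) ((integrable_testFn (dirDeriv v f)).congr (Filter.Eventually.of_forall fun x =>
      (one_smul ℝ (fderiv ℝ (f : ℝ × ℝ → ℂ) x v)).symm))
    ((integrable_testFn f).congr (Filter.Eventually.of_forall fun x =>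
      (one_smul ℝ ((f : ℝ × ℝ → ℂ) x)).symm))
    (fun x _ => hasFDerivAt_const _ _)
    (fun x _ => (f.2.1.differentiable (by simp) x).hasFDerivAt)
  change ∫ x, fderiv ℝ (f : ℝ × ℝ → ℂ) x v = 0
  simpa using h

theorem planeIntegral_restrictFst (x : ℝ × ℝ) (f : TestFn) :
    planeIntegral (restrictFst x (atZ f)) = planeIntegral f :=
  integral_add_left_eq_self (f : ℝ × ℝ → ℂ) x

theorem planeIntegral_restrictSnd (y : ℝ × ℝ) (f : TestFn) :
    planeIntegral (restrictSnd y (atZ f)) = planeIntegral f :=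
  integral_add_right_eq_self (f : ℝ × ℝ → ℂ) y

theorem restrictFst_zero_atZ (f : TestFn) : restrictFst 0 (atZ f) = f := by
  ext z
  change (f : ℝ × ℝ → ℂ) (0 + z) = _
  rw [zero_add]

theorem exists_bump : ∃ ρ : ℝ → ℂ, ContDiff ℝ ∞ ρ ∧ HasCompactSupport ρ ∧ ∫ x, ρ x = 1 := by
  let b : ContDiffBump (0 : ℝ) := ⟨1, 2, one_pos, one_lt_two⟩
  refine ⟨fun x => (b.normed volume x : ℂ), Complex.ofRealCLM.contDiff.comp b.contDiff_normed,
    (b.hasCompactSupport_normed (μ := volume)).comp_left (g := ((↑) : ℝ → ℂ)) (by simp), ?_⟩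
  rw [integral_complex_ofReal, b.integral_normed, Complex.ofReal_one]

/-- The product `(z₊, z₋) ↦ f(z₊) g(z₋)` of two functions of one variable. -/
noncomputable def prodFn (f g : ℝ → ℂ) (hf : ContDiff ℝ ∞ f ∧ HasCompactSupport f)
    (hg : ContDiff ℝ ∞ g ∧ HasCompactSupport g) : TestFn :=
  ⟨fun z => f z.1 * g z.2, (hf.1.comp contDiff_fst).mul (hg.1.comp contDiff_snd), by
    refine HasCompactSupport.intro (hf.2.isCompact.prod hg.2.isCompact) fun z hz => ?_
    rw [mem_prod, not_and_or] at hz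
    rcases hz with h | h
    · rw [image_eq_zero_of_notMem_tsupport h, zero_mul]
    · rw [image_eq_zero_of_notMem_tsupport h, mul_zero]⟩

/-- The integral of a test function over the first variable is smooth and compactly supported. -/
theorem marginal_testFn (f : TestFn) :
    ContDiff ℝ ∞ (fun y => ∫ x, (f : ℝ × ℝ → ℂ) (x, y)) ∧
      HasCompactSupport fun y => ∫ x, (f : ℝ × ℝ → ℂ) (x, y) := by
  constructor
  · have h := (contDiff_slice_integral f volume).comp
      (contDiff_const.prodMk contDiff_id : ContDiff ℝ ∞ fun y : ℝ => ((0 : ℝ), y))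
    convert h using 2 with y
    exact (integral_sub_left_eq_self (fun s => (f : ℝ × ℝ → ℂ) (s, y)) volume 0).symm
  · obtain ⟨R, hR⟩ := testFn_vanishes f
    refine HasCompactSupport.intro (isCompact_closedBall (0 : ℝ) R) fun y hy => ?_
    have hy' : R < |y| := by simpa [mem_closedBall_zero_iff] using hy
    simp [hR _ y (Or.inr hy')]

/-- A linear form on test functions, not assumed continuous, that annihilates all derivatives `∂₊g`
and `∂₋g` is a multiple of the integral. -/
theorem eq_smul_planeIntegral (L : TestFn →ₗ[ℂ] ℂ) (hP : ∀ f, L (dP f) = 0)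
    (hM : ∀ f, L (dM f) = 0) : ∃ c : ℂ, ∀ f, L f = c * planeIntegral f := by
  obtain ⟨ρ, hρ1, hρ2, hρ3⟩ := exists_bump
  refine ⟨L (prodFn ρ ρ ⟨hρ1, hρ2⟩ ⟨hρ1, hρ2⟩), fun f => ?_⟩
  have hm := marginal_testFn f
  set m : ℝ → ℂ := fun y => ∫ x, (f : ℝ × ℝ → ℂ) (x, y) with hmdef
  have hint : planeIntegral f = ∫ y, m y :=
    integral_prod_symm _ (integrable_testFn f)
  have hρi : Integrable ρ := hρ1.continuous.integrable_of_hasCompactSupport hρ2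
  have hmi : Integrable m := hm.1.continuous.integrable_of_hasCompactSupport hm.2
  -- `f - ρ ⊗ m` has zero integrals over `z₊`, and `ρ ⊗ m - (∫ m) ρ ⊗ ρ` has zero integrals over `z₋`.
  obtain ⟨g, hg⟩ := exists_dP_eq (f - prodFn ρ m ⟨hρ1, hρ2⟩ hm) fun y => by
    change ∫ x, ((f : ℝ × ℝ → ℂ) (x, y) - ρ x * m y) = 0
    rw [integral_sub ((slice_contDiff f y).continuous.integrable_of_hasCompactSupport
      (slice_hasCompactSupport f y)) (hρi.mul_const _), integral_mul_const, hρ3, one_mul, sub_self]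
  obtain ⟨k, hk⟩ := exists_dM_eq (prodFn ρ m ⟨hρ1, hρ2⟩ hm
      - (∫ y, m y) • prodFn ρ ρ ⟨hρ1, hρ2⟩ ⟨hρ1, hρ2⟩) fun x => by
    change ∫ y, (ρ x * m y - (∫ y, m y) * (ρ x * ρ y)) = 0
    rw [integral_sub (hmi.const_mul _) ((hρi.const_mul _).const_mul _), integral_const_mul,
      integral_const_mul, integral_const_mul, hρ3]
    ring
  have h1 := hP g
  have h2 := hM k
  rw [hg, map_sub, sub_eq_zero] at h1
  rw [hk, map_sub, map_smul, sub_eq_zero] at h2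
  rw [h1, h2, hint, smul_eq_mul, mul_comm]

theorem exists_planeIntegral_eq_one : ∃ f : TestFn, planeIntegral f = 1 := by
  obtain ⟨ρ, hρ1, hρ2, hρ3⟩ := exists_bump
  refine ⟨prodFn ρ ρ ⟨hρ1, hρ2⟩ ⟨hρ1, hρ2⟩, ?_⟩
  change ∫ z : ℝ × ℝ, ρ z.1 * ρ z.2 = 1
  rw [Measure.volume_eq_prod, integral_prod_mul, hρ3, one_mul]

end TestFunctions

/-! ### Monomials, and the Haar functional of `A(E(1,1|p))` -/

section Monomials

theorem pow_mul_pow_of_skew {R : Type*} [Ring R] [Algebra ℂ R] {c : ℂ} {X Y : R}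
    (h : Y * X = c • (X * Y)) (a b : ℕ) : Y ^ a * X ^ b = c ^ (a * b) • (X ^ b * Y ^ a) := by
  have h1 : Y * X ^ b = c ^ b • (X ^ b * Y) := by
    induction b with
    | zero => simp
    | succ b ih =>
      rw [pow_succ, ← mul_assoc, ih, smul_mul_assoc, mul_assoc, h, mul_smul_comm, smul_smul,
        ← mul_assoc, pow_succ]
  induction a with
  | zero => simp
  | succ a ih =>
    rw [pow_succ', mul_assoc, ih, mul_smul_comm, ← mul_assoc, h1, smul_mul_assoc, smul_smul,
      mul_assoc, add_mul, one_mul, pow_add]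

variable {p : ℕ} {q : ℂ}

theorem delta_etaP (hq0 : q ≠ 0) : delta p q * etaP p q = (q ^ 2)⁻¹ • (etaP p q * delta p q) := by
  rw [etaP_delta, smul_smul, inv_mul_cancel₀ (pow_ne_zero 2 hq0), one_smul]

theorem delta_etaM (hq0 : q ≠ 0) : delta p q * etaM p q = (q ^ 2)⁻¹ • (etaM p q * delta p q) := by
  rw [etaM_delta, smul_smul, inv_mul_cancel₀ (pow_ne_zero 2 hq0), one_smul]

theorem etaP_pow_of_le {n : ℕ} (h : p ≤ n) : etaP p q ^ n = 0 :=
  pow_eq_zero_of_le h (etaP_pow p q)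

theorem etaM_pow_of_le {n : ℕ} (h : p ≤ n) : etaM p q ^ n = 0 :=
  pow_eq_zero_of_le h (etaM_pow p q)

theorem deltaInv_eq_pow (hp : 0 < p) : deltaInv p q = delta p q ^ (p - 1) := by
  have h := congrArg (deltaInv p q * ·) (delta_pow p q)
  obtain ⟨r, rfl⟩ : ∃ r, p = r + 1 := ⟨p - 1, by omega⟩
  simp only [pow_succ', ← mul_assoc, deltaInv_delta, one_mul, mul_one] at h
  simpa using h.symm

variable (p q) in
/-- The monomial `η₊ⁿ η₋ᵐ δᵏ`. -/
noncomputable def monomial (n m k : ℕ) : RedAlg p q := etaP p q ^ n * etaM p q ^ m * delta p q ^ k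

theorem monomial_eq_zero {n m k : ℕ} (h : p ≤ n ∨ p ≤ m) : monomial p q n m k = 0 := by
  rcases h with h | h
  · rw [monomial, etaP_pow_of_le h, zero_mul, zero_mul]
  · rw [monomial, etaM_pow_of_le h, mul_zero, zero_mul]

theorem etaP_mul_monomial (n m k : ℕ) :
    etaP p q * monomial p q n m k = monomial p q (n + 1) m k := by
  simp only [monomial, pow_succ', mul_assoc]

theorem etaM_mul_monomial (n m k : ℕ) :
    etaM p q * monomial p q n m k = (q ^ 2) ^ n • monomial p q n (m + 1) k := by
  have h := pow_mul_pow_of_skew (etaM_etaP p q) 1 n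
  rw [pow_one, one_mul] at h
  rw [monomial, ← mul_assoc, ← mul_assoc, h, smul_mul_assoc, smul_mul_assoc, monomial,
    mul_assoc (etaP p q ^ n), ← pow_succ']

theorem delta_mul_monomial (hq0 : q ≠ 0) (n m k : ℕ) :
    delta p q * monomial p q n m k = ((q ^ 2)⁻¹) ^ (n + m) • monomial p q n m (k + 1) := by
  have h1 := pow_mul_pow_of_skew (delta_etaP (p := p) hq0) 1 n
  have h2 := pow_mul_pow_of_skew (delta_etaM (p := p) hq0) 1 m
  rw [pow_one, one_mul] at h1 h2
  rw [monomial, ← mul_assoc, ← mul_assoc, h1, smul_mul_assoc, smul_mul_assoc,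
    mul_assoc (etaP p q ^ n), h2, mul_smul_comm, smul_mul_assoc, smul_smul, ← pow_add, monomial,
    pow_succ' _ k, mul_assoc, mul_assoc, mul_assoc]

theorem monomial_mul_etaP_pow (hq0 : q ≠ 0) (n m k j : ℕ) : ∃ c : ℂ, c ≠ 0 ∧
    monomial p q n m k * etaP p q ^ j = c • monomial p q (n + j) m k := by
  refine ⟨((q ^ 2)⁻¹) ^ (k * j) * (q ^ 2) ^ (m * j), 
    mul_ne_zero (pow_ne_zero _ (inv_ne_zero (pow_ne_zero _ hq0)))
      (pow_ne_zero _ (pow_ne_zero _ hq0)), ?_⟩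
  rw [monomial, mul_assoc, pow_mul_pow_of_skew (delta_etaP hq0) k j, mul_smul_comm,
    ← mul_assoc, mul_assoc (etaP p q ^ n), pow_mul_pow_of_skew (etaM_etaP p q) m j,
    mul_smul_comm, smul_mul_assoc, smul_smul, ← mul_assoc, ← pow_add, monomial]

theorem monomial_mul_etaM_pow (hq0 : q ≠ 0) (n m k j : ℕ) : ∃ c : ℂ, c ≠ 0 ∧
    monomial p q n m k * etaM p q ^ j = c • monomial p q n (m + j) k := by
  refine ⟨((q ^ 2)⁻¹) ^ (k * j), pow_ne_zero _ (inv_ne_zero (pow_ne_zero _ hq0)), ?_⟩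
  rw [monomial, mul_assoc, pow_mul_pow_of_skew (delta_etaM hq0) k j, mul_smul_comm,
    ← mul_assoc, mul_assoc (etaP p q ^ n), ← pow_add, monomial]

/-- Induction on elements of `A(E(1,1|p))`, from scalars and generators. -/
theorem redAlg_induction {C : RedAlg p q → Prop} (h1 : ∀ c : ℂ, C (algebraMap ℂ _ c))
    (hg : ∀ g, C (gen p q g)) (ha : ∀ a b, C a → C b → C (a + b))
    (hm : ∀ a b, C a → C b → C (a * b)) (a : RedAlg p q) : C a := by
  obtain ⟨x, rfl⟩ := RingQuot.mkAlgHom_surjective ℂ (Rel p q) a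
  induction x using FreeAlgebra.induction with
  | grade0 c => rw [AlgHom.commutes]; exact h1 c
  | grade1 g => exact hg g
  | mul x y hx hy => rw [map_mul]; exact hm _ _ hx hy
  | add x y hx hy => rw [map_add]; exact ha _ _ hx hy

variable (p q) in
theorem span_monomial (hp : 0 < p) (hq0 : q ≠ 0) :
    Submodule.span ℂ {a | ∃ n m k, n < p ∧ m < p ∧ a = monomial p q n m k} = ⊤ := by
  set S := Submodule.span ℂ {a | ∃ n m k, n < p ∧ m < p ∧ a = monomial p q n m k} with hS
  have hmem : ∀ n m k, monomial p q n m k ∈ S := by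
    intro n m k
    by_cases h : n < p ∧ m < p
    · exact Submodule.subset_span ⟨n, m, k, h.1, h.2, rfl⟩
    · rw [monomial_eq_zero (by omega)]
      exact S.zero_mem
  have hstep : ∀ a : RedAlg p q, (∀ n m k, a * monomial p q n m k ∈ S) → ∀ s ∈ S, a * s ∈ S := by
    intro a h s hs
    induction hs using Submodule.span_induction with
    | mem x hx =>
      obtain ⟨n, m, k, -, -, rfl⟩ := hx
      exact h n m k
    | zero => rw [mul_zero]; exact S.zero_mem
    | add x y _ _ hx hy => rw [mul_add]; exact S.add_mem hx hy
    | smul c x _ hx => rw [mul_smul_comm]; exact S.smul_mem c hx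
  have hdelta : ∀ s ∈ S, delta p q * s ∈ S := hstep _ fun n m k => by
    rw [delta_mul_monomial hq0]
    exact S.smul_mem _ (hmem _ _ _)
  have hmul : ∀ a : RedAlg p q, ∀ s ∈ S, a * s ∈ S := by
    refine redAlg_induction (fun c s hs => ?_) (fun g => ?_) (fun a b ha hb s hs => ?_)
      (fun a b ha hb s hs => ?_)
    · rw [← Algebra.smul_def]
      exact S.smul_mem c hs
    · cases g with
      | etaP =>
        refine hstep _ fun n m k => ?_
        change etaP p q * _ ∈ S
        rw [etaP_mul_monomial]
        exact hmem _ _ _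
      | etaM =>
        refine hstep _ fun n m k => ?_
        change etaM p q * _ ∈ S
        rw [etaM_mul_monomial]
        exact S.smul_mem _ (hmem _ _ _)
      | delta => exact hdelta
      | deltaInv =>
        change ∀ s ∈ S, deltaInv p q * s ∈ S
        rw [deltaInv_eq_pow hp]
        generalize p - 1 = r
        induction r with
        | zero => simp
        | succ r ih =>
          intro s hs
          rw [pow_succ', mul_assoc]
          exact hdelta _ (ih s hs)
    · rw [add_mul]
      exact S.add_mem (ha s hs) (hb s hs)
    · rw [mul_assoc]
      exact ha _ (hb s hs)
  rw [eq_top_iff]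
  intro a _
  have h1 : (1 : RedAlg p q) ∈ S := by simpa [monomial] using hmem 0 0 0
  simpa using hmul a 1 h1

theorem linearMap_ext_monomial {N : Type*} [AddCommMonoid N] [Module ℂ N] (hp : 0 < p)
    (hq0 : q ≠ 0) {J K : RedAlg p q →ₗ[ℂ] N}
    (h : ∀ n m k, n < p → m < p → J (monomial p q n m k) = K (monomial p q n m k)) : J = K := by
  refine LinearMap.ext_on (span_monomial p q hp hq0) ?_
  rintro _ ⟨n, m, k, hn, hm, rfl⟩
  exact h n m k hn hm

end Monomials

section Haar

theorem gauss_self (μ : ℂ) (n : ℕ) : gauss μ n n = 1 := by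
  induction n with
  | zero => simp [gauss]
  | succ n ih => rw [gauss, gauss_eq_zero μ n (n + 1) (by omega), ih]; simp

variable {p : ℕ} {q : ℂ} (hp : Odd p) (hq : IsPrimitiveRoot q p)

/-- The coproduct of a monomial, by the q-binomial theorem in both pairs of q-commuting summands. -/
theorem comul_monomial (n m k : ℕ) : comul hp hq (monomial p q n m k)
    = ∑ i ∈ Finset.range (n + 1), ∑ j ∈ Finset.range (m + 1),
      (gauss ((q ^ 2)⁻¹) n i * gauss (q ^ 2) m j) •
        ((etaP p q ^ (n - i) * delta p q ^ i * (etaM p q ^ (m - j) * deltaInv p q ^ j)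
          * delta p q ^ k) ⊗ₜ[ℂ] monomial p q i j k) := by
  have hq0 : q ^ 2 ≠ 0 := pow_ne_zero _ (hq.ne_zero hp.pos.ne')
  have hP := add_pow_gauss (R := RedAlg p q ⊗[ℂ] RedAlg p q) (q ^ 2)⁻¹
    (etaP p q ⊗ₜ 1) (delta p q ⊗ₜ etaP p q) (by
      simp only [Algebra.TensorProduct.tmul_mul_tmul, one_mul, mul_one, etaP_delta,
        TensorProduct.smul_tmul', smul_smul, inv_mul_cancel₀ hq0, one_smul]) n
  have hM := add_pow_gauss (R := RedAlg p q ⊗[ℂ] RedAlg p q) (q ^ 2)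
    (etaM p q ⊗ₜ 1) (deltaInv p q ⊗ₜ etaM p q) (by
      simp only [Algebra.TensorProduct.tmul_mul_tmul, one_mul, mul_one, deltaInv_etaM,
        TensorProduct.smul_tmul']) m
  simp only [monomial, etaP, etaM, delta, map_mul, map_pow, comul_gen, comulGen]
  simp only [etaP, etaM, delta] at hP hM
  rw [hP, hM, Finset.sum_mul_sum, Finset.sum_mul]
  refine Finset.sum_congr rfl fun i _ => ?_
  rw [Finset.sum_mul]
  refine Finset.sum_congr rfl fun j _ => ?_
  simp only [smul_mul_assoc, mul_smul_comm, smul_smul, Algebra.TensorProduct.tmul_pow,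
    Algebra.TensorProduct.tmul_mul_tmul, one_pow, one_mul]
  rw [mul_comm]

/-- In `(id ⊗ ℐ)Δ(a)` only the term with `η₊^{p-1} η₋^{p-1}` on the right counts, and it occurs for
`a = η₊^{p-1} η₋^{p-1} δᵏ` only, with `δ^{p-1} δ^{-(p-1)} δᵏ` on the left. -/
theorem redIntegral_left_invariant (a : RedAlg p q) :
    TensorProduct.rid ℂ (RedAlg p q) (TensorProduct.map LinearMap.id (redIntegral hp hq)
      (comul hp hq a)) = redIntegral hp hq a • (1 : RedAlg p q) := by
  have hq0 : q ≠ 0 := hq.ne_zero hp.pos.ne'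
  suffices h : (TensorProduct.rid ℂ (RedAlg p q)).toLinearMap
      ∘ₗ TensorProduct.map LinearMap.id (redIntegral hp hq) ∘ₗ (comul hp hq).toLinearMap
      = (LinearMap.toSpanSingleton ℂ (RedAlg p q) 1) ∘ₗ redIntegral hp hq from
    LinearMap.congr_fun h a
  refine linearMap_ext_monomial hp.pos hq0 fun n m k hn hm => ?_
  change TensorProduct.rid ℂ (RedAlg p q) (TensorProduct.map LinearMap.id (redIntegral hp hq)
      (comul hp hq (monomial p q n m k)))
    = redIntegral hp hq (monomial p q n m k) • (1 : RedAlg p q)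
  have hI : ∀ i j, i < p → j < p → redIntegral hp hq (monomial p q i j k)
      = if i = p - 1 ∧ j = p - 1 ∧ p ∣ k then q⁻¹ else 0 :=
    fun i j hi hj => redIntegral_monomial hp hq i j k hi hj
  rw [comul_monomial]
  simp only [map_sum, map_smul, TensorProduct.map_tmul, TensorProduct.rid_tmul, LinearMap.id_apply]
  by_cases h : n = p - 1 ∧ m = p - 1 ∧ p ∣ k
  · obtain ⟨rfl, rfl, hk⟩ := h
    rw [Finset.sum_eq_single_of_mem (p - 1) (by simp), Finset.sum_eq_single_of_mem (p - 1) (by simp)]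
    · obtain ⟨l, rfl⟩ := hk
      have hc : Commute (delta p q) (deltaInv p q) := by
        rw [commute_iff_eq, deltaInv_delta, delta_deltaInv]
      simp only [gauss_self, Nat.sub_self, pow_zero, one_mul, one_smul, pow_mul, delta_pow,
        one_pow, mul_one, ← hc.mul_pow, delta_deltaInv]
    · intro j hj hne
      have := Finset.mem_range.mp hj
      rw [hI _ _ hn (by omega), if_neg (fun h => hne h.2.1), zero_smul, smul_zero]
    · intro i hi hne
      have := Finset.mem_range.mp hi
      refine Finset.sum_eq_zero fun j hj => ?_
      have := Finset.mem_range.mp hj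
      rw [hI _ _ (by omega) (by omega), if_neg (fun h => hne h.1), zero_smul, smul_zero]
  · rw [hI n m hn hm, if_neg h, zero_smul]
    refine Finset.sum_eq_zero fun i hi => Finset.sum_eq_zero fun j hj => ?_
    have := Finset.mem_range.mp hi
    have := Finset.mem_range.mp hj
    rw [hI _ _ (by omega) (by omega), if_neg (by omega), zero_smul, smul_zero]

/-- In `(ℐ ⊗ id)Δ(a)` only the term `a ⊗ δᵏ` for `a = η₊^{p-1} η₋^{p-1} δᵏ` counts. -/
theorem redIntegral_right_invariant (a : RedAlg p q) :
    TensorProduct.lid ℂ (RedAlg p q) (TensorProduct.map (redIntegral hp hq) LinearMap.id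
      (comul hp hq a)) = redIntegral hp hq a • (1 : RedAlg p q) := by
  have hq0 : q ≠ 0 := hq.ne_zero hp.pos.ne'
  suffices h : (TensorProduct.lid ℂ (RedAlg p q)).toLinearMap
      ∘ₗ TensorProduct.map (redIntegral hp hq) LinearMap.id ∘ₗ (comul hp hq).toLinearMap
      = (LinearMap.toSpanSingleton ℂ (RedAlg p q) 1) ∘ₗ redIntegral hp hq from
    LinearMap.congr_fun h a
  refine linearMap_ext_monomial hp.pos hq0 fun n m k hn hm => ?_
  change TensorProduct.lid ℂ (RedAlg p q) (TensorProduct.map (redIntegral hp hq) LinearMap.id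
      (comul hp hq (monomial p q n m k)))
    = redIntegral hp hq (monomial p q n m k) • (1 : RedAlg p q)
  have hI : ∀ i j k, i < p → j < p → redIntegral hp hq (monomial p q i j k)
      = if i = p - 1 ∧ j = p - 1 ∧ p ∣ k then q⁻¹ else 0 :=
    fun i j k hi hj => redIntegral_monomial hp hq i j k hi hj
  have hfac : ∀ i j, etaP p q ^ (n - i) * delta p q ^ i * (etaM p q ^ (m - j) * deltaInv p q ^ j)
      * delta p q ^ k
      = ((q ^ 2)⁻¹) ^ (i * (m - j)) • monomial p q (n - i) (m - j) (i + (p - 1) * j + k) := by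
    intro i j
    rw [← mul_assoc, mul_assoc _ (delta p q ^ i), pow_mul_pow_of_skew (delta_etaM hq0),
      deltaInv_eq_pow hp.pos, monomial]
    simp only [mul_smul_comm, smul_mul_assoc, ← pow_mul, pow_add, mul_assoc]
  rw [comul_monomial]
  simp only [map_sum, map_smul, TensorProduct.map_tmul, TensorProduct.lid_tmul, LinearMap.id_apply,
    hfac]
  by_cases h : n = p - 1 ∧ m = p - 1 ∧ p ∣ k
  · obtain ⟨rfl, rfl, hk⟩ := h
    rw [Finset.sum_eq_single_of_mem 0 (by simp), Finset.sum_eq_single_of_mem 0 (by simp)]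
    · obtain ⟨l, rfl⟩ := hk
      simp [gauss_zero, monomial, pow_mul, delta_pow]
    · intro j hj hne
      have := Finset.mem_range.mp hj
      rw [hI _ _ _ (by omega) (by omega), if_neg (by omega), smul_zero, zero_smul, smul_zero]
    · intro i hi hne
      have := Finset.mem_range.mp hi
      refine Finset.sum_eq_zero fun j hj => ?_
      have := Finset.mem_range.mp hj
      rw [hI _ _ _ (by omega) (by omega), if_neg (by omega), smul_zero, zero_smul, smul_zero]
  · rw [hI n m k hn hm, if_neg h, zero_smul]
    refine Finset.sum_eq_zero fun i hi => Finset.sum_eq_zero fun j hj => ?_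
    have := Finset.mem_range.mp hi
    have := Finset.mem_range.mp hj
    rw [hI _ _ _ (by omega) (by omega)]
    by_cases h' : n - i = p - 1 ∧ m - j = p - 1 ∧ p ∣ i + (p - 1) * j + k
    · obtain ⟨h1, h2, h3⟩ := h'
      obtain rfl : i = 0 := by omega
      obtain rfl : j = 0 := by omega
      exact absurd ⟨by omega, by omega, by simpa using h3⟩ h
    · rw [if_neg h', smul_zero, zero_smul, smul_zero]

end Haar

/-! ### Invariance of `ℐ_E` -/

section Existence

variable {p : ℕ} {q : ℂ} (hp : Odd p) (hq : IsPrimitiveRoot q p)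

theorem sliceRight_integralE (x : ℝ × ℝ) (t : RedAlg p q ⊗[ℂ] RedAlg p q) (g : TwoPointFn) :
    sliceRight (integralE hp hq) x (t ⊗ₜ g) = planeIntegral (restrictFst x g) •
      TensorProduct.rid ℂ (RedAlg p q) (TensorProduct.map LinearMap.id (redIntegral hp hq) t) := by
  induction t using TensorProduct.induction_on with
  | zero => simp
  | tmul a b =>
    rw [sliceRight_tmul]
    simp [integralE, smul_smul, mul_comm]
  | add t u ht hu => rw [TensorProduct.add_tmul, map_add, ht, hu, map_add, map_add, smul_add]

theorem sliceLeft_integralE (y : ℝ × ℝ) (t : RedAlg p q ⊗[ℂ] RedAlg p q) (g : TwoPointFn) :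
    sliceLeft (integralE hp hq) y (t ⊗ₜ g) = planeIntegral (restrictSnd y g) •
      TensorProduct.lid ℂ (RedAlg p q) (TensorProduct.map (redIntegral hp hq) LinearMap.id t) := by
  induction t using TensorProduct.induction_on with
  | zero => simp
  | tmul a b =>
    rw [sliceLeft_tmul]
    simp [integralE, smul_smul, mul_comm]
  | add t u ht hu => rw [TensorProduct.add_tmul, map_add, ht, hu, map_add, map_add, smul_add]

theorem comulE_tmul (a : RedAlg p q) (f : TestFn) : comulE hp hq (a ⊗ₜ f)
    = comul hp hq a ⊗ₜ atZ f + (comul hp hq a * BP p q) ⊗ₜ atZ (dP f)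
      + (comul hp hq a * BM p q) ⊗ₜ atZ (dM f)
      + (comul hp hq a * (BP p q * BM p q)) ⊗ₜ atZ (dP (dM f)) := by
  simp [comulE, comulTerm, mul_assoc]

theorem isInvariantIntegral_integralE : IsInvariantIntegral hp hq (integralE hp hq) := by
  have hE : ∀ a f, integralE hp hq (a ⊗ₜ f) = redIntegral hp hq a * planeIntegral f := by
    simp [integralE]
  constructor
  · intro F x
    induction F using TensorProduct.induction_on with
    | zero => simp
    | tmul a f =>
      rw [comulE_tmul, map_add, map_add, map_add]
      simp only [sliceRight_integralE, planeIntegral_restrictFst, dP, dM, planeIntegral_dirDeriv,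
        zero_smul, add_zero]
      rw [redIntegral_left_invariant, smul_smul, hE, mul_comm]
    | add F G hF hG => rw [map_add, map_add, hF, hG, map_add, add_smul]
  · intro F y
    induction F using TensorProduct.induction_on with
    | zero => simp
    | tmul a f =>
      rw [comulE_tmul, map_add, map_add, map_add]
      simp only [sliceLeft_integralE, planeIntegral_restrictSnd, dP, dM, planeIntegral_dirDeriv,
        zero_smul, add_zero]
      rw [redIntegral_right_invariant, smul_smul, hE, mul_comm]
    | add F G hF hG => rw [map_add, map_add, hF, hG, map_add, add_smul]

theorem integralE_ne_zero : integralE hp hq ≠ 0 := by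
  intro h
  obtain ⟨f, hf⟩ := exists_planeIntegral_eq_one
  have hpp := hp.pos
  have h1 := LinearMap.congr_fun h
    ((etaP p q ^ (p - 1) * etaM p q ^ (p - 1) * delta p q ^ 0) ⊗ₜ f)
  have h2 := redIntegral_monomial hp hq (p - 1) (p - 1) 0 (by omega) (by omega)
  rw [if_pos (by simp)] at h2
  simp only [integralE, LinearMap.comp_apply, TensorProduct.map_tmul, h2, hf,
    LinearMap.mul'_apply, mul_one, LinearMap.zero_apply, inv_eq_zero] at h1
  exact hq.ne_zero hp.pos.ne' h1

end Existence

/-! ### Two-dimensional representations of `A(E(1,1|p))` -/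

section Jet

/-- The matrices of the generators in the representation `jet`. -/
noncomputable def jetGen (q s t : ℂ) : Gen → Matrix (Fin 2) (Fin 2) ℂ
  | Gen.etaP => !![0, s; 0, 0]
  | Gen.etaM => !![0, t; 0, 0]
  | Gen.delta => !![1, 0; 0, q ^ 2]
  | Gen.deltaInv => !![1, 0; 0, (q ^ 2)⁻¹]

/-- Powers of the images `(jet s t ⊗ id)Δ(η_±)`; the off-diagonal entry is a q-derivative of the
power. -/
theorem upper_pow_succ {R : Type*} [Ring R] [Algebra ℂ R] (c s : ℂ) (X : R) (n : ℕ) :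
    !![X, algebraMap ℂ R s; 0, c • X] ^ (n + 1)
      = !![X ^ (n + 1), (s * ∑ i ∈ Finset.range (n + 1), c ^ i) • X ^ n;
          0, c ^ (n + 1) • X ^ (n + 1)] := by
  induction n with
  | zero => simp [Algebra.algebraMap_eq_smul_one]
  | succ n ih =>
    rw [pow_succ', ih, Matrix.mul_fin_two, Finset.sum_range_succ _ (n + 1), mul_add, add_smul]
    simp only [mul_zero, zero_mul, zero_add, add_zero, smul_zero, smul_mul_assoc, smul_smul,
      mul_smul_comm, Algebra.algebraMap_eq_smul_one, one_mul, ← pow_succ', ← pow_succ,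
      mul_comm s (c ^ (n + 1))]

theorem diag_pow {R : Type*} [Ring R] [Algebra ℂ R] (c : ℂ) (X : R) (n : ℕ) :
    !![X, 0; 0, c • X] ^ n = !![X ^ n, 0; 0, c ^ n • X ^ n] := by
  induction n with
  | zero => simp [Matrix.one_fin_two]
  | succ n ih =>
    rw [pow_succ, ih, Matrix.mul_fin_two]
    simp only [mul_zero, add_zero, zero_mul, zero_add, smul_mul_smul_comm, ← pow_succ]

theorem nilpotent_mul (s t : ℂ) :
    !![0, s; 0, 0] * !![0, t; 0, 0] = (0 : Matrix (Fin 2) (Fin 2) ℂ) := by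
  rw [Matrix.mul_fin_two]
  ext i j
  fin_cases i <;> fin_cases j <;> simp

theorem nilpotent_pow (s : ℂ) {n : ℕ} (hn : 2 ≤ n) :
    !![0, s; 0, 0] ^ n = (0 : Matrix (Fin 2) (Fin 2) ℂ) :=
  pow_eq_zero_of_le hn (by rw [pow_two, nilpotent_mul])

variable {p : ℕ} {q : ℂ}

theorem jetGen_rel (hp1 : 1 < p) (hq : IsPrimitiveRoot q p) (s t : ℂ)
    ⦃x y : FreeAlgebra ℂ Gen⦄ (h : Rel p q x y) :
    FreeAlgebra.lift ℂ (jetGen q s t) x = FreeAlgebra.lift ℂ (jetGen q s t) y := by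
  have hq0 : q ^ 2 ≠ 0 := pow_ne_zero _ (hq.ne_zero (by omega))
  cases h with
  | eta_eta =>
    simp only [map_mul, map_smul, FreeAlgebra.lift_ι_apply, jetGen, nilpotent_mul, smul_zero]
  | etaP_delta =>
    simp only [map_mul, map_smul, FreeAlgebra.lift_ι_apply, jetGen, Matrix.mul_fin_two]
    ext i j
    fin_cases i <;> fin_cases j <;> simp [mul_comm]
  | etaM_delta =>
    simp only [map_mul, map_smul, FreeAlgebra.lift_ι_apply, jetGen, Matrix.mul_fin_two]
    ext i j
    fin_cases i <;> fin_cases j <;> simp [mul_comm]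
  | delta_inv => simp [jetGen, Matrix.one_fin_two, hq0]
  | inv_delta => simp [jetGen, Matrix.one_fin_two, hq0]
  | delta_pow =>
    have h := diag_pow (q ^ 2) (1 : ℂ) p
    rw [smul_eq_mul, mul_one] at h
    simp only [map_pow, map_one, FreeAlgebra.lift_ι_apply, jetGen, h]
    rw [← pow_mul, mul_comm 2, pow_mul, hq.pow_eq_one]
    simp [Matrix.one_fin_two]
  | etaP_pow =>
    simp only [map_pow, map_zero, FreeAlgebra.lift_ι_apply, jetGen, nilpotent_pow s hp1]
  | etaM_pow =>
    simp only [map_pow, map_zero, FreeAlgebra.lift_ι_apply, jetGen, nilpotent_pow t hp1]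

/-- The representation of `A(E(1,1|p))` on `ℂ²` with `η₊ ↦ s E₁₂`, `η₋ ↦ t E₁₂` and
`δ ↦ diag(1, q²)`. The parameters `s` and `t` allow either of `η₊`, `η₋` to be switched off. -/
noncomputable def jet (hp1 : 1 < p) (hq : IsPrimitiveRoot q p) (s t : ℂ) :
    RedAlg p q →ₐ[ℂ] Matrix (Fin 2) (Fin 2) ℂ :=
  RingQuot.liftAlgHom ℂ ⟨FreeAlgebra.lift ℂ (jetGen q s t), jetGen_rel hp1 hq s t⟩

theorem jet_gen (hp1 : 1 < p) (hq : IsPrimitiveRoot q p) (s t : ℂ) (g : Gen) :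
    jet hp1 hq s t (gen p q g) = jetGen q s t g := by
  simp [jet, gen]

/-- The homomorphism `jet s t ⊗ id`, with values in the two by two matrices over `A(E(1,1|p))`. -/
noncomputable def jetTensor (hp1 : 1 < p) (hq : IsPrimitiveRoot q p) (s t : ℂ) :
    RedAlg p q ⊗[ℂ] RedAlg p q →ₐ[ℂ] Matrix (Fin 2) (Fin 2) (RedAlg p q) :=
  Algebra.TensorProduct.lift ((Algebra.ofId ℂ (RedAlg p q)).mapMatrix.comp (jet hp1 hq s t))
    (Matrix.scalarAlgHom (Fin 2) ℂ) fun a b => by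
      rw [commute_iff_eq]
      ext i j
      simp [Matrix.scalar_apply, Matrix.mul_diagonal, Matrix.diagonal_mul, Algebra.ofId_apply,
        Algebra.commutes]

variable (hp1 : 1 < p) (hq : IsPrimitiveRoot q p) (s t : ℂ)

theorem jetTensor_tmul (a b : RedAlg p q) (i j : Fin 2) :
    jetTensor hp1 hq s t (a ⊗ₜ b) i j = jet hp1 hq s t a i j • b := by
  simp [jetTensor, Matrix.scalar_apply, Matrix.mul_diagonal, Algebra.ofId_apply, Algebra.smul_def]

/-- Matrix entries of `jet s t` applied to `(id ⊗ J)` can be taken before `J` is applied. -/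
theorem jet_sliceRight (J : CompactAlg p q →ₗ[ℂ] ℂ) (x : ℝ × ℝ)
    (u : RedAlg p q ⊗[ℂ] RedAlg p q) (g : TwoPointFn) (i j : Fin 2) :
    jet hp1 hq s t (sliceRight J x (u ⊗ₜ g)) i j
      = J (jetTensor hp1 hq s t u i j ⊗ₜ restrictFst x g) := by
  induction u using TensorProduct.induction_on with
  | zero => simp
  | tmul a b =>
    rw [sliceRight_tmul, jetTensor_tmul, map_smul, Matrix.smul_apply, ← TensorProduct.smul_tmul',
      map_smul, smul_eq_mul, smul_eq_mul, mul_comm]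
  | add u v hu hv =>
    rw [TensorProduct.add_tmul, map_add, map_add, Matrix.add_apply, hu, hv, map_add,
      Matrix.add_apply, TensorProduct.add_tmul, map_add]

theorem jetTensor_comul_etaP (hp : Odd p) : jetTensor hp1 hq s t (comul hp hq (etaP p q))
    = !![etaP p q, algebraMap ℂ _ s; 0, q ^ 2 • etaP p q] := by
  rw [etaP, comul_gen, comulGen, map_add]
  ext i j
  rw [Matrix.add_apply, jetTensor_tmul, jetTensor_tmul, etaP, delta, jet_gen, jet_gen]
  fin_cases i <;> fin_cases j <;> simp [jetGen, Algebra.algebraMap_eq_smul_one]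

theorem jetTensor_comul_etaM (hp : Odd p) : jetTensor hp1 hq s t (comul hp hq (etaM p q))
    = !![etaM p q, algebraMap ℂ _ t; 0, (q ^ 2)⁻¹ • etaM p q] := by
  rw [etaM, comul_gen, comulGen, map_add]
  ext i j
  rw [Matrix.add_apply, jetTensor_tmul, jetTensor_tmul, etaM, deltaInv, jet_gen, jet_gen]
  fin_cases i <;> fin_cases j <;> simp [jetGen, Algebra.algebraMap_eq_smul_one]

theorem jetTensor_comul_delta (hp : Odd p) : jetTensor hp1 hq s t (comul hp hq (delta p q))
    = !![delta p q, 0; 0, q ^ 2 • delta p q] := by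
  rw [delta, comul_gen, comulGen]
  ext i j
  rw [jetTensor_tmul, delta, jet_gen]
  fin_cases i <;> fin_cases j <;> simp [jetGen]

theorem jetTensor_comul_monomial (hp : Odd p) (n m k : ℕ) :
    jetTensor hp1 hq s t (comul hp hq (monomial p q n m k))
      = !![etaP p q, algebraMap ℂ _ s; 0, q ^ 2 • etaP p q] ^ n
        * !![etaM p q, algebraMap ℂ _ t; 0, (q ^ 2)⁻¹ • etaM p q] ^ m
        * !![delta p q, 0; 0, q ^ 2 • delta p q] ^ k := by
  simp only [monomial, map_mul, map_pow, jetTensor_comul_etaP, jetTensor_comul_etaM,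
    jetTensor_comul_delta]

theorem jetTensor_comul_monomial_diag (hp : Odd p) (n m k : ℕ) :
    jetTensor hp1 hq 0 0 (comul hp hq (monomial p q n m k))
      = !![monomial p q n m k, 0; 0, ((q ^ 2) ^ n * ((q ^ 2)⁻¹) ^ m * (q ^ 2) ^ k) •
          monomial p q n m k] := by
  rw [jetTensor_comul_monomial]
  simp only [map_zero, diag_pow, Matrix.mul_fin_two, mul_zero, add_zero,
    zero_mul, zero_add, smul_mul_smul_comm, monomial]

theorem jetTensor_comul_monomial_etaP (hp : Odd p) (n m k : ℕ) :
    jetTensor hp1 hq 1 0 (comul hp hq (monomial p q (n + 1) m k))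
      = !![monomial p q (n + 1) m k,
          ((∑ i ∈ Finset.range (n + 1), (q ^ 2) ^ i) * ((q ^ 2)⁻¹) ^ m * (q ^ 2) ^ k) •
            monomial p q n m k;
          0, ((q ^ 2) ^ (n + 1) * ((q ^ 2)⁻¹) ^ m * (q ^ 2) ^ k) • monomial p q (n + 1) m k] := by
  rw [jetTensor_comul_monomial]
  simp only [map_zero, upper_pow_succ, diag_pow, Matrix.mul_fin_two,
    mul_zero, add_zero, zero_mul, zero_add, smul_mul_smul_comm, one_mul, monomial]

theorem jetTensor_comul_monomial_etaM (hp : Odd p) (n m k : ℕ) :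
    jetTensor hp1 hq 0 1 (comul hp hq (monomial p q n (m + 1) k))
      = !![monomial p q n (m + 1) k,
          ((q ^ 2) ^ k * ∑ i ∈ Finset.range (m + 1), ((q ^ 2)⁻¹) ^ i) • monomial p q n m k;
          0, ((q ^ 2) ^ k * (((q ^ 2)⁻¹) ^ (m + 1) * (q ^ 2) ^ n)) • monomial p q n (m + 1) k] := by
  rw [jetTensor_comul_monomial]
  simp only [map_zero, upper_pow_succ, diag_pow, Matrix.mul_fin_two,
    mul_zero, add_zero, zero_mul, zero_add, smul_zero, smul_mul_assoc, mul_smul_comm, smul_smul,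
    one_mul, monomial]

theorem qNum_ne_zero {p : ℕ} {q : ℂ} (hq : IsPrimitiveRoot q p) {n : ℕ} (hp : Odd p)
    (hn : 0 < n) (hnp : n < p) : qNum q n ≠ 0 := by
  have hq0 : q ≠ 0 := hq.ne_zero (by omega)
  have key : ∀ n, 0 < n → n < p → q ^ n - (q ^ n)⁻¹ ≠ 0 := by
    intro n hn hnp h
    have h1 : (q ^ 2) ^ n = 1 := by
      have h2 : q ^ n = (q ^ n)⁻¹ := sub_eq_zero.mp h
      rw [← pow_mul, mul_comm, pow_mul, pow_two]
      nth_rewrite 2 [h2]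
      exact mul_inv_cancel₀ (pow_ne_zero _ hq0)
    exact (sq_primitive hp hq).pow_ne_one_of_pos_of_lt (by omega) hnp h1
  have h1 := key 1 one_pos (by omega)
  rw [pow_one] at h1
  exact div_ne_zero (key n hn hnp) h1

theorem qFact_ne_zero {p : ℕ} {q : ℂ} (hq : IsPrimitiveRoot q p) {n : ℕ} (hp : Odd p)
    (hnp : n < p) : qFact q n ≠ 0 :=
  Finset.prod_ne_zero_iff.mpr fun i hi =>
    qNum_ne_zero hq hp (by omega) (by have := Finset.mem_range.mp hi; omega)

theorem geom_sum_ne_zero {μ : ℂ} (hμ : IsPrimitiveRoot μ p) {n : ℕ} (hn : 0 < n) (hnp : n < p) :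
    ∑ i ∈ Finset.range n, μ ^ i ≠ 0 := by
  intro h
  have h1 := geom_sum_mul μ n
  rw [h, zero_mul] at h1
  exact hμ.pow_ne_one_of_pos_of_lt (by omega) hnp (sub_eq_zero.mp h1.symm)

/-- Only the term `η₊ δ^{p-1} ⊗ η₊^{p-1}` of `B₊` survives, with a nonzero coefficient, since
`jet s t` maps the square of `η₊` to zero. -/
theorem jetTensor_BP (hp : Odd p) : ∃ κ : ℂ, κ ≠ 0 ∧ ∀ s t, jetTensor hp1 hq s t (BP p q)
    = !![0, (s * κ) • etaP p q ^ (p - 1); 0, 0] := by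
  have hq0 : q ≠ 0 := hq.ne_zero (by omega)
  refine ⟨(-1 : ℂ) ^ ((p + 1) / 2) * (q ^ ((p - 1) ^ 2) / (qFact q (p - (p - 1)) * qFact q (p - 1)))
    * (q ^ 2) ^ (p - 1), ?_, fun s t => ?_⟩
  · refine mul_ne_zero (mul_ne_zero (by simp) (div_ne_zero (pow_ne_zero _ hq0)
      (mul_ne_zero (qFact_ne_zero hq hp (by omega)) (qFact_ne_zero hq hp (by omega)))))
      (pow_ne_zero _ (pow_ne_zero _ hq0))
  have hterm : ∀ n ∈ Finset.Ico 1 p, n ≠ p - 1 → jetTensor hp1 hq s t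
      ((etaP p q ^ (p - n) * delta p q ^ n) ⊗ₜ[ℂ] (etaP p q ^ n)) = 0 := by
    intro n hn hne
    have := Finset.mem_Ico.mp hn
    ext i j
    rw [jetTensor_tmul, map_mul, map_pow, etaP, jet_gen, jetGen, nilpotent_pow s (by omega)]
    simp
  rw [BP, map_smul, map_sum, Finset.sum_eq_single_of_mem (p - 1) (by simp; omega)]
  · have hd := diag_pow (q ^ 2) (1 : ℂ) (p - 1)
    rw [smul_eq_mul, mul_one] at hd
    ext i j
    rw [map_smul, Matrix.smul_apply, Matrix.smul_apply, jetTensor_tmul, map_mul, map_pow, map_pow]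
    nth_rewrite 1 [etaP]
    rw [delta, jet_gen, jet_gen, jetGen, jetGen, hd, show p - (p - 1) = 1 by omega, pow_one,
      Matrix.mul_fin_two, smul_smul, smul_smul]
    fin_cases i <;> fin_cases j <;> simp
    ring_nf
  · intro n hn hne
    rw [map_smul, hterm n hn hne, smul_zero]

/-- Only the term `η₋ δ^{-(p-1)} ⊗ η₋^{p-1}` of `B₋` survives, with a nonzero coefficient. -/
theorem jetTensor_BM (hp : Odd p) : ∃ κ : ℂ, κ ≠ 0 ∧ ∀ s t, jetTensor hp1 hq s t (BM p q)
    = !![0, (t * κ) • etaM p q ^ (p - 1); 0, 0] := by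
  have hq0 : q ≠ 0 := hq.ne_zero (by omega)
  refine ⟨(-1 : ℂ) ^ ((p + 1) / 2)
    * ((q ^ ((p - 1) ^ 2))⁻¹ / (qFact q (p - (p - 1)) * qFact q (p - 1)))
    * ((q ^ 2)⁻¹) ^ (p - 1), ?_, fun s t => ?_⟩
  · refine mul_ne_zero (mul_ne_zero (by simp) (div_ne_zero (inv_ne_zero (pow_ne_zero _ hq0))
      (mul_ne_zero (qFact_ne_zero hq hp (by omega)) (qFact_ne_zero hq hp (by omega)))))
      (pow_ne_zero _ (inv_ne_zero (pow_ne_zero _ hq0)))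
  have hterm : ∀ n ∈ Finset.Ico 1 p, n ≠ p - 1 → jetTensor hp1 hq s t
      ((etaM p q ^ (p - n) * deltaInv p q ^ n) ⊗ₜ[ℂ] (etaM p q ^ n)) = 0 := by
    intro n hn hne
    have := Finset.mem_Ico.mp hn
    ext i j
    rw [jetTensor_tmul, map_mul, map_pow, etaM, jet_gen, jetGen, nilpotent_pow t (by omega)]
    simp
  rw [BM, map_smul, map_sum, Finset.sum_eq_single_of_mem (p - 1) (by simp; omega)]
  · have hd := diag_pow ((q ^ 2)⁻¹) (1 : ℂ) (p - 1)
    rw [smul_eq_mul, mul_one] at hd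
    ext i j
    rw [map_smul, Matrix.smul_apply, Matrix.smul_apply, jetTensor_tmul, map_mul, map_pow, map_pow]
    nth_rewrite 1 [etaM]
    rw [deltaInv, jet_gen, jet_gen, jetGen, jetGen, hd, show p - (p - 1) = 1 by omega, pow_one,
      Matrix.mul_fin_two, smul_smul, smul_smul]
    fin_cases i <;> fin_cases j <;> simp
    ring_nf
  · intro n hn hne
    rw [map_smul, hterm n hn hne, smul_zero]

end Jet

/-! ### Uniqueness of the invariant integral -/

section Uniqueness

variable {p : ℕ} {q : ℂ} (hp : Odd p) (hq : IsPrimitiveRoot q p)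
  {J : CompactAlg p q →ₗ[ℂ] ℂ}

/-- The matrix entries of `jet s t` of the left invariance of `J` at the origin of the plane. -/
theorem jet_invariance (hp1 : 1 < p) (hJ : IsInvariantIntegral hp hq J) (s t : ℂ) (a : RedAlg p q)
    (f : TestFn) (i j : Fin 2) :
    J (jetTensor hp1 hq s t (comul hp hq a) i j ⊗ₜ f)
      + J ((jetTensor hp1 hq s t (comul hp hq a) * jetTensor hp1 hq s t (BP p q)) i j ⊗ₜ dP f)
      + J ((jetTensor hp1 hq s t (comul hp hq a) * jetTensor hp1 hq s t (BM p q)) i j ⊗ₜ dM f)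
      + J ((jetTensor hp1 hq s t (comul hp hq a) * (jetTensor hp1 hq s t (BP p q)
          * jetTensor hp1 hq s t (BM p q))) i j ⊗ₜ dP (dM f))
      = J (a ⊗ₜ f) * (1 : Matrix (Fin 2) (Fin 2) ℂ) i j := by
  have h := congrArg (fun b => jet hp1 hq s t b i j) (hJ.left_invariant (a ⊗ₜ f) 0)
  simp only [comulE_tmul, map_add, Matrix.add_apply, jet_sliceRight, restrictFst_zero_atZ,
    map_mul, map_smul, map_one, Matrix.smul_apply, smul_eq_mul] at h
  exact h

/-- The equation for `a = η₊ⁿ⁺¹ η₋ᵐ δᵏ`: the term with `B₊` carries a power of `η₊` that is zero. -/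
theorem invariant_etaP_lower (hp1 : 1 < p) (hJ : IsInvariantIntegral hp hq J) {n : ℕ}
    (hn : n + 1 < p) (m k : ℕ) (f : TestFn) : J (monomial p q n m k ⊗ₜ f) = 0 := by
  have hq0 : q ≠ 0 := hq.ne_zero (by omega)
  obtain ⟨κ, -, hP⟩ := jetTensor_BP hp1 hq hp
  obtain ⟨κ', -, hM⟩ := jetTensor_BM hp1 hq hp
  obtain ⟨c, -, hc⟩ := monomial_mul_etaP_pow (p := p) hq0 (n + 1) m k (p - 1)
  rw [monomial_eq_zero (n := n + 1 + (p - 1)) (by omega), smul_zero] at hc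
  have h := jet_invariance hp hq hp1 hJ 1 0 (monomial p q (n + 1) m k) f 0 1
  rw [hP, hM, jetTensor_comul_monomial_etaP] at h
  simp only [Matrix.mul_fin_two] at h
  simp [hc, ← TensorProduct.smul_tmul', hq0] at h
  exact h.resolve_left (geom_sum_ne_zero (sq_primitive hp hq) (by omega) hn)

/-- The equation for `a = η₊ⁿ η₋ᵐ⁺¹ δᵏ`: the term with `B₋` carries a power of `η₋` that is zero. -/
theorem invariant_etaM_lower (hp1 : 1 < p) (hJ : IsInvariantIntegral hp hq J) {m : ℕ}
    (hm : m + 1 < p) (n k : ℕ) (f : TestFn) : J (monomial p q n m k ⊗ₜ f) = 0 := by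
  have hq0 : q ≠ 0 := hq.ne_zero (by omega)
  obtain ⟨κ, -, hP⟩ := jetTensor_BP hp1 hq hp
  obtain ⟨κ', -, hM⟩ := jetTensor_BM hp1 hq hp
  obtain ⟨c, -, hc⟩ := monomial_mul_etaM_pow (p := p) hq0 n (m + 1) k (p - 1)
  rw [monomial_eq_zero (m := m + 1 + (p - 1)) (by omega), smul_zero] at hc
  have h := jet_invariance hp hq hp1 hJ 0 1 (monomial p q n (m + 1) k) f 0 1
  rw [hP, hM, jetTensor_comul_monomial_etaM] at h
  simp only [Matrix.mul_fin_two] at h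
  simp [hc, ← TensorProduct.smul_tmul', hq0, -inv_pow] at h
  exact h.resolve_left (geom_sum_ne_zero (sq_primitive hp hq).inv (by omega) hm)

/-- The equation for `a = η₋ᵐ δᵏ`: only the term with `B₊` has an off-diagonal entry. -/
theorem invariant_dP (hp1 : 1 < p) (hJ : IsInvariantIntegral hp hq J) (m k : ℕ) (f : TestFn) :
    J (monomial p q (p - 1) m k ⊗ₜ dP f) = 0 := by
  have hq0 : q ≠ 0 := hq.ne_zero (by omega)
  obtain ⟨κ, hκ, hP⟩ := jetTensor_BP hp1 hq hp
  obtain ⟨κ', -, hM⟩ := jetTensor_BM hp1 hq hp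
  obtain ⟨c, hc0, hc⟩ := monomial_mul_etaP_pow (p := p) hq0 0 m k (p - 1)
  rw [monomial, pow_zero, one_mul, zero_add] at hc
  have h := jet_invariance hp hq hp1 hJ 1 0 (monomial p q 0 m k) f 0 1
  rw [hP, hM, jetTensor_comul_monomial, pow_zero, one_mul, map_zero, diag_pow, diag_pow] at h
  simp only [Matrix.mul_fin_two] at h
  simp [← TensorProduct.smul_tmul', hκ] at h
  rw [hc, ← TensorProduct.smul_tmul', map_smul, smul_eq_mul] at h
  exact (mul_eq_zero.mp h).resolve_left hc0

/-- The equation for `a = η₊ⁿ δᵏ`: only the term with `B₋` has an off-diagonal entry. -/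
theorem invariant_dM (hp1 : 1 < p) (hJ : IsInvariantIntegral hp hq J) (n k : ℕ) (f : TestFn) :
    J (monomial p q n (p - 1) k ⊗ₜ dM f) = 0 := by
  have hq0 : q ≠ 0 := hq.ne_zero (by omega)
  obtain ⟨κ, -, hP⟩ := jetTensor_BP hp1 hq hp
  obtain ⟨κ', hκ, hM⟩ := jetTensor_BM hp1 hq hp
  obtain ⟨c, hc0, hc⟩ := monomial_mul_etaM_pow (p := p) hq0 n 0 k (p - 1)
  rw [monomial, pow_zero, mul_one, zero_add] at hc
  have h := jet_invariance hp hq hp1 hJ 0 1 (monomial p q n 0 k) f 0 1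
  rw [hP, hM, jetTensor_comul_monomial, pow_zero, mul_one, map_zero, diag_pow, diag_pow] at h
  simp only [Matrix.mul_fin_two] at h
  simp [← TensorProduct.smul_tmul', hκ] at h
  rw [hc, ← TensorProduct.smul_tmul', map_smul, smul_eq_mul] at h
  exact (mul_eq_zero.mp h).resolve_left hc0

theorem invariant_top (hp1 : 1 < p) (hJ : IsInvariantIntegral hp hq J) {k : ℕ} (hk : ¬ p ∣ k)
    (f : TestFn) : J (monomial p q (p - 1) (p - 1) k ⊗ₜ f) = 0 := by
  have hq0 : q ≠ 0 := hq.ne_zero (by omega)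
  obtain ⟨κ, -, hP⟩ := jetTensor_BP hp1 hq hp
  obtain ⟨κ', -, hM⟩ := jetTensor_BM hp1 hq hp
  have h := jet_invariance hp hq hp1 hJ 0 0 (monomial p q (p - 1) (p - 1) k) f 1 1
  have hne : (q ^ 2) ^ k ≠ 1 := fun h => hk (((sq_primitive hp hq).pow_eq_one_iff_dvd k).mp h)
  rw [hP, hM, jetTensor_comul_monomial_diag, ← mul_pow, mul_inv_cancel₀ (pow_ne_zero 2 hq0),
    one_pow, one_mul] at h
  simp only [Matrix.mul_fin_two] at h
  simp [← TensorProduct.smul_tmul'] at h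
  have h1 : ((q ^ 2) ^ k - 1) * J (monomial p q (p - 1) (p - 1) k ⊗ₜ f) = 0 := by
    rw [sub_one_mul, h, sub_self]
  exact (mul_eq_zero.mp h1).resolve_left (sub_ne_zero.mpr hne)

theorem eq_smul_integralE (hp1 : 1 < p) (hJ : IsInvariantIntegral hp hq J) :
    ∃ c : ℂ, J = c • integralE hp hq := by
  have hq0 : q ≠ 0 := hq.ne_zero (by omega)
  obtain ⟨c, hc⟩ := eq_smul_planeIntegral
    (TensorProduct.curry J (monomial p q (p - 1) (p - 1) 0))
    (invariant_dP hp hq hp1 hJ _ _) (invariant_dM hp hq hp1 hJ _ _)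
  -- The factor `q` cancels the `q⁻¹` in the normalization of `ℐ`.
  refine ⟨c * q, TensorProduct.curry_injective (linearMap_ext_monomial hp.pos hq0
    fun n m k hn hm => LinearMap.ext fun f => ?_)⟩
  have hI := redIntegral_monomial hp hq n m k hn hm
  change J (monomial p q n m k ⊗ₜ f)
    = c * q * (redIntegral hp hq (monomial p q n m k) * planeIntegral f)
  rw [monomial, hI, ← monomial]
  by_cases hn' : n + 1 < p
  · rw [invariant_etaP_lower hp hq hp1 hJ hn', if_neg (by omega), zero_mul, mul_zero]
  by_cases hm' : m + 1 < p
  · rw [invariant_etaM_lower hp hq hp1 hJ hm', if_neg (by omega), zero_mul, mul_zero]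
  obtain rfl : n = p - 1 := by omega
  obtain rfl : m = p - 1 := by omega
  by_cases hk : p ∣ k
  · have h0 : monomial p q (p - 1) (p - 1) k = monomial p q (p - 1) (p - 1) 0 := by
      obtain ⟨l, rfl⟩ := hk
      simp only [monomial, pow_mul, delta_pow, one_pow, pow_zero]
    rw [if_pos ⟨rfl, rfl, hk⟩, h0]
    refine (hc f).trans ?_
    field_simp
  · rw [invariant_top hp hq hp1 hJ hk, if_neg (fun h => hk h.2.2), zero_mul, mul_zero]

end Uniqueness

end QPoincare

theorem theorem2 (p : ℕ) (q : ℂ) (hp : Odd p) (hp1 : 1 < p) (hq : IsPrimitiveRoot q p) :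
    QPoincare.IsInvariantIntegral hp hq (QPoincare.integralE hp hq) ∧
    QPoincare.integralE hp hq ≠ 0 ∧
    ∀ J : QPoincare.CompactAlg p q →ₗ[ℂ] ℂ, QPoincare.IsInvariantIntegral hp hq J →
      ∃ c : ℂ, J = c • QPoincare.integralE hp hq :=
  ⟨QPoincare.isInvariantIntegral_integralE hp hq, QPoincare.integralE_ne_zero hp hq,
    fun _ hJ => QPoincare.eq_smul_integralE hp hq hp1 hJ⟩
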